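/- Let $X,Y\subset\mathbb R^n$ be open sets, $Y$ bounded, and let $c:X\times Y\to\mathbb R$ satisfy: * (C0) $c\in C^4(X\times Y)$ with $\|c\|_{C^4(X\times Y)}<\infty$; * (C1) for every $x\in X$ the map $Y\ni y\mapsto -D_xc(x,y)$ is injective; * (C2) for every $y\in Y$ the map $X\ni x\mapsto -D_yc(x,y)$ is injective; * (C3) $\det(D_{xy}c)(x,y)\neq0$ for all $(x,y)\in X\times Y$. Assume moreover that $c$ extends continuously to $X\times\overline Y$ (the extension is still denoted by $c$; then $D_xc$ also exists and is continuous on $X\times\overline Y$), and that $Y$ is $c$-convex, i.e. $D_xc(x,Y)$ is convex for every $x\in X$. Definitions. A function $\psi:X\to\mathbb R\cup\{+\infty\}$, $\psi\not\equiv+\infty$, is *$c$-convex* if $\psi(x)=\sup_{y\in Y}[\psi^c(y)-c(x,y)]$ for all $x\in X$, where $\psi^c(y)=\inf_{x\in X}[\psi(x)+c(x,y)]$. Its $c$-subdifferential and Fréchet subdifferential at $x\in X$ are $$\partial_c\psi(x)=\{y\in\overline Y:\ \psi(z)\ge -c(z,y)+c(x,y)+\psi(x)\ \ \forall z\in X\},$$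 $$\partial^-\psi(x)=\{p\in\mathbb R^n:\ \psi(z)\ge\psi(x)+p\cdot(z-x)+o(|z-x|)\ \text{as } z\to x\}.$$ For $p\in -D_xc(x,Y)$, $\operatorname{c-exp}_x(p)$ is the point $y\in Y$ with $p=-D_xc(x,y)$; for $A\subset\overline Y$ put $(\operatorname{c-exp}_x)^{-1}(A)=-D_xc(x,A)$. For $\bar x\in X$ and $y_0,y_1\in Y$, the $c$-segment $[y_0,y_1]_{\bar x}=(y_t)_{t\in[0,1]}$ is given by $y_t=\operatorname{c-exp}_{\bar x}\bigl((1-t)(\operatorname{c-exp}_{\bar x})^{-1}(y_0)+t(\operatorname{c-exp}_{\bar x})^{-1}(y_1)\bigr)$. Consider the following conditions: * (i) For every $c$-convex $\psi$ and every $\bar x\in X$, $\partial_c\psi(\bar x)$ is connected. * (ii) For every $c$-convex $\psi$ and every $\bar x\in X$, $(\operatorname{c-exp}_{\bar x})^{-1}(\partial_c\psi(\bar x))$ is convex and coincides with $\partial^-\psi(\bar x)$. * (iii) For all $\bar x\in X$ and $y_0,y_1\in Y$, if $[y_0,y_1]_{\bar x}=(y_t)_{t\in[0,1]}\subset Y$,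 then for all $x\in X$ and $t\in[0,1]$ $$c(x,y_t)-c(\bar x,y_t)\ \ge\ \min\bigl[c(x,y_0)-c(\bar x,y_0),\ c(x,y_1)-c(\bar x,y_1)\bigr].$$ * (iv) (MTW(0)) For all $\bar x\in X$, $y\in Y$ and $\xi,\eta\in\mathbb R^n$ with $\xi\perp\eta$, with $p=(\operatorname{c-exp}_{\bar x})^{-1}(y)$, $$\frac{d^2}{ds^2}\Big|_{s=0}\frac{d^2}{dt^2}\Big|_{t=0}\,c\bigl(\bar x+t\xi,\ \operatorname{c-exp}_{\bar x}(p+s\eta)\bigr)\le0 .$$ Then (i), (ii) and (iii) are equivalent, and they imply (iv). If in addition $D_yc(X,y)$ is convex for every $y\in Y$, then all four conditions (i)–(iv) are equivalent. Moreover, suppose that the functions $c(\cdot,y)$, $y\in Y$, are Lipschitz on $X$ with a common constant (this is automatic from (C0) when $X$ is convex). If any one of (i)–(iv) is not satisfied, then the $C^1$ $c$-convex functions are not dense in the set of Lipschitz $c$-convex functions on $X$, for the topology of uniform convergence on compact subsets of $X$. -/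

import Mathlib

open Set Filter Topology

namespace OptimalTransport

noncomputable section

/-- `D_x c(x, y)`, as a vector of `ℝⁿ`. -/
def gradX {n : ℕ} (c : EuclideanSpace ℝ (Fin n) → EuclideanSpace ℝ (Fin n) → ℝ)
    (x y : EuclideanSpace ℝ (Fin n)) : EuclideanSpace ℝ (Fin n) :=
  gradient (fun x' => c x' y) x

/-- `D_y c(x, y)`, as a vector of `ℝⁿ`. -/
def gradY {n : ℕ} (c : EuclideanSpace ℝ (Fin n) → EuclideanSpace ℝ (Fin n) → ℝ)
    (x y : EuclideanSpace ℝ (Fin n)) : EuclideanSpace ℝ (Fin n) :=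
  gradient (fun y' => c x y') y

/-- Condition (C0): `c` is of class `C⁴` on `X × Y`, with finite `C⁴` norm. -/
def CondC0 {n : ℕ} (c : EuclideanSpace ℝ (Fin n) → EuclideanSpace ℝ (Fin n) → ℝ)
    (X Y : Set (EuclideanSpace ℝ (Fin n))) : Prop :=
  ContDiffOn ℝ 4 (Function.uncurry c) (X ×ˢ Y) ∧
    ∃ M : ℝ, ∀ k : ℕ, k ≤ 4 → ∀ z ∈ X ×ˢ Y, ‖iteratedFDeriv ℝ k (Function.uncurry c) z‖ ≤ M

/-- Condition (C1): for every `x ∈ X`, the map `y ↦ -D_x c(x, y)` is injective on `Y`. -/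
def CondC1 {n : ℕ} (c : EuclideanSpace ℝ (Fin n) → EuclideanSpace ℝ (Fin n) → ℝ)
    (X Y : Set (EuclideanSpace ℝ (Fin n))) : Prop :=
  ∀ x ∈ X, InjOn (fun y => -gradX c x y) Y

/-- Condition (C2): for every `y ∈ Y`, the map `x ↦ -D_y c(x, y)` is injective on `X`. -/
def CondC2 {n : ℕ} (c : EuclideanSpace ℝ (Fin n) → EuclideanSpace ℝ (Fin n) → ℝ)
    (X Y : Set (EuclideanSpace ℝ (Fin n))) : Prop :=
  ∀ y ∈ Y, InjOn (fun x => -gradY c x y) X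

/-- Condition (C3): `det (D_{xy} c)(x, y) ≠ 0` on `X × Y`. -/
def CondC3 {n : ℕ} (c : EuclideanSpace ℝ (Fin n) → EuclideanSpace ℝ (Fin n) → ℝ)
    (X Y : Set (EuclideanSpace ℝ (Fin n))) : Prop :=
  ∀ x ∈ X, ∀ y ∈ Y, (fderiv ℝ (fun y' => gradX c x y') y).det ≠ 0

/-- The `c`-transform `ψᶜ(y) = inf_{x ∈ X} [ψ(x) + c(x, y)]`. -/
def cTransform {n : ℕ} (c : EuclideanSpace ℝ (Fin n) → EuclideanSpace ℝ (Fin n) → ℝ)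
    (X : Set (EuclideanSpace ℝ (Fin n))) (ψ : EuclideanSpace ℝ (Fin n) → EReal)
    (y : EuclideanSpace ℝ (Fin n)) : EReal :=
  ⨅ x ∈ X, (ψ x + (c x y : EReal))

/-- `ψ : X → ℝ ∪ {+∞}`, not identically `+∞` (so that `ψᶜ` takes values in `ℝ ∪ {-∞}`), is
`c`-convex: `ψ(x) = sup_{y ∈ Y} [ψᶜ(y) - c(x, y)]` for all `x ∈ X`.
Values of `ψ` outside `X` play no role. -/
def IsCConvex {n : ℕ} (c : EuclideanSpace ℝ (Fin n) → EuclideanSpace ℝ (Fin n) → ℝ)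
    (X Y : Set (EuclideanSpace ℝ (Fin n))) (ψ : EuclideanSpace ℝ (Fin n) → EReal) : Prop :=
  (∀ x ∈ X, ψ x ≠ ⊥) ∧ (∃ x ∈ X, ψ x ≠ ⊤) ∧
    ∀ x ∈ X, ψ x = ⨆ y ∈ Y, (cTransform c X ψ y - (c x y : EReal))

/-- The `c`-subdifferential
`∂_c ψ(x) = {y ∈ closure Y | ψ(z) ≥ -c(z, y) + c(x, y) + ψ(x) for all z ∈ X}`. -/
def cSubdiff {n : ℕ} (c : EuclideanSpace ℝ (Fin n) → EuclideanSpace ℝ (Fin n) → ℝ)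
    (X Y : Set (EuclideanSpace ℝ (Fin n))) (ψ : EuclideanSpace ℝ (Fin n) → EReal)
    (x : EuclideanSpace ℝ (Fin n)) : Set (EuclideanSpace ℝ (Fin n)) :=
  {y | y ∈ closure Y ∧ ∀ z ∈ X, ((-c z y + c x y : ℝ) : EReal) + ψ x ≤ ψ z}

/-- The Fréchet subdifferential
`∂⁻ψ(x) = {p | ψ(z) ≥ ψ(x) + p · (z - x) + o(|z - x|)}`, as `z → x` in `X`. -/
def frechetSubdiff {n : ℕ} (X : Set (EuclideanSpace ℝ (Fin n)))
    (ψ : EuclideanSpace ℝ (Fin n) → EReal) (x : EuclideanSpace ℝ (Fin n)) :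
    Set (EuclideanSpace ℝ (Fin n)) :=
  {p | ∀ ε : ℝ, 0 < ε → ∀ᶠ z in 𝓝[X] x,
    ψ x + ((inner ℝ p (z - x) - ε * ‖z - x‖ : ℝ) : EReal) ≤ ψ z}

/-- The `c`-exponential map: for `p ∈ -D_x c(x, Y)`, `cExp c Y x p` is the point `y ∈ Y` with
`p = -D_x c(x, y)` (it is only used for such `p`). -/
def cExp {n : ℕ} (c : EuclideanSpace ℝ (Fin n) → EuclideanSpace ℝ (Fin n) → ℝ)
    (Y : Set (EuclideanSpace ℝ (Fin n))) (x p : EuclideanSpace ℝ (Fin n)) :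
    EuclideanSpace ℝ (Fin n) :=
  Function.invFunOn (fun y => -gradX c x y) Y p

/-- The point at time `t` of the segment in `ℝⁿ` from `(cexp_x)⁻¹(y₀) = -D_x c(x, y₀)` to
`(cexp_x)⁻¹(y₁) = -D_x c(x, y₁)`. -/
def pSeg {n : ℕ} (c : EuclideanSpace ℝ (Fin n) → EuclideanSpace ℝ (Fin n) → ℝ)
    (x y₀ y₁ : EuclideanSpace ℝ (Fin n)) (t : ℝ) : EuclideanSpace ℝ (Fin n) :=
  (1 - t) • (-gradX c x y₀) + t • (-gradX c x y₁)

/-- The point `y_t` of the `c`-segment `[y₀, y₁]_x` with base `x`. -/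
def cSeg {n : ℕ} (c : EuclideanSpace ℝ (Fin n) → EuclideanSpace ℝ (Fin n) → ℝ)
    (Y : Set (EuclideanSpace ℝ (Fin n))) (x y₀ y₁ : EuclideanSpace ℝ (Fin n)) (t : ℝ) :
    EuclideanSpace ℝ (Fin n) :=
  cExp c Y x (pSeg c x y₀ y₁ t)

/-- The `c`-segment `[y₀, y₁]_x` is well defined and contained in `Y`. -/
def CSegIn {n : ℕ} (c : EuclideanSpace ℝ (Fin n) → EuclideanSpace ℝ (Fin n) → ℝ)
    (Y : Set (EuclideanSpace ℝ (Fin n))) (x y₀ y₁ : EuclideanSpace ℝ (Fin n)) : Prop :=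
  ∀ t ∈ Icc (0 : ℝ) 1, pSeg c x y₀ y₁ t ∈ (fun y => -gradX c x y) '' Y

/-- All `c`-subdifferentials of `c`-convex functions are connected. -/
def ConnectedSubdiffs {n : ℕ} (c : EuclideanSpace ℝ (Fin n) → EuclideanSpace ℝ (Fin n) → ℝ)
    (X Y : Set (EuclideanSpace ℝ (Fin n))) : Prop :=
  ∀ ψ : EuclideanSpace ℝ (Fin n) → EReal, IsCConvex c X Y ψ →
    ∀ x ∈ X, IsConnected (cSubdiff c X Y ψ x)

/-- For `c`-convex `ψ` the set `(cexp_x)⁻¹(∂_c ψ(x)) = -D_x c(x, ∂_c ψ(x))` is convex and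
coincides with `∂⁻ψ(x)`. -/
def ConvexSubdiffs {n : ℕ} (c : EuclideanSpace ℝ (Fin n) → EuclideanSpace ℝ (Fin n) → ℝ)
    (X Y : Set (EuclideanSpace ℝ (Fin n))) : Prop :=
  ∀ ψ : EuclideanSpace ℝ (Fin n) → EReal, IsCConvex c X Y ψ →
    ∀ x ∈ X, Convex ℝ ((fun y => -gradX c x y) '' cSubdiff c X Y ψ x) ∧
      (fun y => -gradX c x y) '' cSubdiff c X Y ψ x = frechetSubdiff X ψ x

/-- The inequality along `c`-segments
`c(x, y_t) - c(x̄, y_t) ≥ min [c(x, y₀) - c(x̄, y₀), c(x, y₁) - c(x̄, y₁)]`. -/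
def CSegInequality {n : ℕ} (c : EuclideanSpace ℝ (Fin n) → EuclideanSpace ℝ (Fin n) → ℝ)
    (X Y : Set (EuclideanSpace ℝ (Fin n))) : Prop :=
  ∀ xb ∈ X, ∀ y₀ ∈ Y, ∀ y₁ ∈ Y, CSegIn c Y xb y₀ y₁ →
    ∀ x ∈ X, ∀ t ∈ Icc (0 : ℝ) 1,
      min (c x y₀ - c xb y₀) (c x y₁ - c xb y₁) ≤
        c x (cSeg c Y xb y₀ y₁ t) - c xb (cSeg c Y xb y₀ y₁ t)

/-- The fourth-order condition MTW(0): for `x ∈ X`, `y ∈ Y`, `p = -D_x c(x, y)`, and `ξ ⊥ η`,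
`d²/ds²|_{s=0} d²/dt²|_{t=0} c(x + tξ, cexp_x(p + sη)) ≤ 0`. -/
def MTWZero {n : ℕ} (c : EuclideanSpace ℝ (Fin n) → EuclideanSpace ℝ (Fin n) → ℝ)
    (X Y : Set (EuclideanSpace ℝ (Fin n))) : Prop :=
  ∀ x ∈ X, ∀ y ∈ Y, ∀ ξ η : EuclideanSpace ℝ (Fin n), inner ℝ ξ η = 0 →
    iteratedDeriv 2 (fun s : ℝ =>
      iteratedDeriv 2 (fun t : ℝ => c (x + t • ξ) (cExp c Y x (-gradX c x y + s • η))) 0) 0 ≤ 0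

/-- `C¹` `c`-convex functions are dense in the set of Lipschitz `c`-convex functions, for the
topology of locally uniform convergence (uniform convergence on compact sets) on `X`. -/
def C1Dense {n : ℕ} (c : EuclideanSpace ℝ (Fin n) → EuclideanSpace ℝ (Fin n) → ℝ)
    (X Y : Set (EuclideanSpace ℝ (Fin n))) : Prop :=
  ∀ ψ : EuclideanSpace ℝ (Fin n) → ℝ, IsCConvex c X Y (fun x => (ψ x : EReal)) →
    (∃ L, LipschitzOnWith L ψ X) →
    ∀ K : Set (EuclideanSpace ℝ (Fin n)), K ⊆ X → IsCompact K → ∀ ε : ℝ, 0 < ε →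
      ∃ φ : EuclideanSpace ℝ (Fin n) → ℝ, IsCConvex c X Y (fun x => (φ x : EReal)) ∧
        ContDiffOn ℝ 1 φ X ∧ ∀ x ∈ K, |φ x - ψ x| < ε

end

end OptimalTransport

/-! Condition (iii) is the hub: it is shown equivalent to (i) and to (ii), it follows from density
of C¹ functions, it implies MTW(0), and it follows from MTW(0) when the sets `D_y c(X, y)` are
convex.

Since `c` is bounded and `closure Y` is compact, a `c`-convex function is finite on `X` and has a
`c`-subgradient at every point. Under (iii), if `y₀, y₁` support `ψ` at `x`, so does every `y_t`;
points of the boundary of `Y`, where `c`-segments are not available, are reached by limits. Hence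
`∂_c ψ(x)` is connected and its image under `-D_x c(x, ·)` is convex and compact. A Fréchet
subgradient lies in that image by Hahn–Banach, because `c`-subgradients at `x + tv`, as `t → 0`,
dominate it in the direction `v`. Conversely, (iii) says exactly that every `y_t` supports at `x`
the maximum of the two `c`-affine functions given by `y₀, y₁` and normalised to vanish at `x`. The
`c`-subgradients of that maximum have their images in the segment from `-D_x c(x, y₀)` to `-D_x c(x,
y₁)`; connectedness or convexity forces the whole segment (`cSegInequality_of_exists`).

If C¹ functions were dense, that maximum `f` would be a limit of C¹ `c`-convex `φ_k`. Minimising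
`φ_k` minus a linear function of slope `p_t`, plus a quadratic penalty, yields points `x_k → x̄`
with `∇φ_k(x_k) → p_t`. The `c`-subgradients of `φ_k` there converge to `y_t`, which therefore
supports `f`: this is (iii) (`cSegInequality_of_c1Dense`).

(iii) implies (iv): expanding (iii) to second order along a suitable parabola `x + tξ + t²aη` shows
that `s ↦ D²_{xx} c(x, cexp_x(p + sη))(ξ, ξ)` satisfies a midpoint concavity inequality at `0`.

(iv) implies (iii): let `h(t) = c(x̄, y_t) - c(x, y_t)`. Join `x̄` to `x` by a curve `γ` along which
`D_y c(·, y_t)` is affine. As `D_x c(x̄, y_t)` is affine in `t`, the quantity `h''(t)` is controlled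
by a fourth-order form along `γ`, evaluated at `v = ẏ_t`. MTW(0), transferred to such curves in
`mtw_dual`, makes this form nonpositive on vectors orthogonal to `w = D_y c(x, y_t) - D_y c(x̄,
y_t)`. Since `w · v = -h'(t)`, what remains is `h'' ≥ -C|h'|`, and a maximum principle gives `h ≤
max(h(0), h(1))`, which is (iii). -/

namespace OptimalTransport

local notation "𝔼" n => EuclideanSpace ℝ (Fin n)

/-- The standing assumptions on the cost `c` and the domains `X`, `Y`. -/
structure Admissible {n : ℕ} (c : (𝔼 n) → (𝔼 n) → ℝ) (X Y : Set (𝔼 n)) : Prop where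
  isOpen_left : IsOpen X
  isOpen_right : IsOpen Y
  isBounded : Bornology.IsBounded Y
  condC0 : CondC0 c X Y
  condC1 : CondC1 c X Y
  condC2 : CondC2 c X Y
  condC3 : CondC3 c X Y
  continuousOn : ContinuousOn (Function.uncurry c) (X ×ˢ closure Y)
  convex : ∀ x ∈ X, Convex ℝ ((fun y => gradX c x y) '' Y)

variable {n : ℕ} {c : (𝔼 n) → (𝔼 n) → ℝ} {X Y : Set (𝔼 n)}

/-! ### Partial gradients of the cost at interior points. -/

namespace Admissible

theorem contDiffAt (h : Admissible c X Y) {x y : 𝔼 n} (hx : x ∈ X) (hy : y ∈ Y) :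
    ContDiffAt ℝ 4 (Function.uncurry c) (x, y) :=
  h.condC0.1.contDiffAt ((h.isOpen_left.prod h.isOpen_right).mem_nhds ⟨hx, hy⟩)

theorem hasFDerivAt (h : Admissible c X Y) {x y : 𝔼 n} (hx : x ∈ X) (hy : y ∈ Y) :
    HasFDerivAt (Function.uncurry c) (fderiv ℝ (Function.uncurry c) (x, y)) (x, y) :=
  ((h.contDiffAt hx hy).differentiableAt (by norm_num)).hasFDerivAt

theorem hasFDerivAt_left (h : Admissible c X Y) {x y : 𝔼 n} (hx : x ∈ X) (hy : y ∈ Y) :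
    HasFDerivAt (fun x' => c x' y)
      ((fderiv ℝ (Function.uncurry c) (x, y)).comp (ContinuousLinearMap.inl ℝ (𝔼 n) (𝔼 n))) x :=
  HasFDerivAt.comp (f := fun e => (e, y)) x (h.hasFDerivAt hx hy) (hasFDerivAt_prodMk_left x y)

theorem hasFDerivAt_right (h : Admissible c X Y) {x y : 𝔼 n} (hx : x ∈ X) (hy : y ∈ Y) :
    HasFDerivAt (fun y' => c x y')
      ((fderiv ℝ (Function.uncurry c) (x, y)).comp (ContinuousLinearMap.inr ℝ (𝔼 n) (𝔼 n))) y :=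
  HasFDerivAt.comp (f := fun e => (x, e)) y (h.hasFDerivAt hx hy) (hasFDerivAt_prodMk_right x y)

theorem gradX_eq (h : Admissible c X Y) {x y : 𝔼 n} (hx : x ∈ X) (hy : y ∈ Y) :
    gradX c x y = (InnerProductSpace.toDual ℝ (𝔼 n)).symm
      ((fderiv ℝ (Function.uncurry c) (x, y)).comp (ContinuousLinearMap.inl ℝ (𝔼 n) (𝔼 n))) := by
  rw [gradX, gradient, (h.hasFDerivAt_left hx hy).fderiv]

theorem gradY_eq (h : Admissible c X Y) {x y : 𝔼 n} (hx : x ∈ X) (hy : y ∈ Y) :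
    gradY c x y = (InnerProductSpace.toDual ℝ (𝔼 n)).symm
      ((fderiv ℝ (Function.uncurry c) (x, y)).comp (ContinuousLinearMap.inr ℝ (𝔼 n) (𝔼 n))) := by
  rw [gradY, gradient, (h.hasFDerivAt_right hx hy).fderiv]

theorem inner_gradX (h : Admissible c X Y) {x y : 𝔼 n} (hx : x ∈ X) (hy : y ∈ Y) (w : 𝔼 n) :
    inner ℝ (gradX c x y) w = fderiv ℝ (Function.uncurry c) (x, y) (w, 0) := by
  rw [h.gradX_eq hx hy, InnerProductSpace.toDual_symm_apply]; simp

theorem inner_gradY (h : Admissible c X Y) {x y : 𝔼 n} (hx : x ∈ X) (hy : y ∈ Y) (w : 𝔼 n) :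
    inner ℝ (gradY c x y) w = fderiv ℝ (Function.uncurry c) (x, y) (0, w) := by
  rw [h.gradY_eq hx hy, InnerProductSpace.toDual_symm_apply]; simp

end Admissible

/-! ### Bounds and gradients of the cost up to the boundary of `Y`. -/

/-- `G` satisfies a first-order expansion of `c(·, y)` at `x` on the ball of radius `r`, with
quadratic error. -/
def QuadBound (c : (𝔼 n) → (𝔼 n) → ℝ) (M r : ℝ) (x y G : 𝔼 n) : Prop :=
  ∀ x' ∈ Metric.ball x r, |c x' y - c x y - inner ℝ G (x' - x)| ≤ M * ‖x' - x‖ ^ 2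

theorem QuadBound.hasGradientAt {M r : ℝ} {x y G : 𝔼 n} (hr : 0 < r)
    (h : QuadBound c M r x y G) : HasGradientAt (fun x' => c x' y) G x := by
  rw [hasGradientAt_iff_hasFDerivAt, hasFDerivAt_iff_isLittleO]
  have h1 : (fun x' => c x' y - c x y - inner ℝ G (x' - x)) =O[𝓝 x]
      fun x' => ‖x' - x‖ ^ 2 := by
    refine Asymptotics.IsBigO.of_bound M ?_
    filter_upwards [Metric.ball_mem_nhds x hr] with x' hx'
    rw [Real.norm_eq_abs, Real.norm_of_nonneg (by positivity)]
    exact h x' hx'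
  have h2 : (fun x' : 𝔼 n => ‖x' - x‖ ^ 2) =o[𝓝 x] fun x' => x' - x :=
    Asymptotics.isLittleO_norm_pow_id one_lt_two |>.comp_tendsto
      (tendsto_sub_nhds_zero_iff.2 tendsto_id)
  simpa using h1.trans_isLittleO h2

theorem QuadBound.gradX_eq {M r : ℝ} {x y G : 𝔼 n} (hr : 0 < r)
    (h : QuadBound c M r x y G) : gradX c x y = G :=
  (h.hasGradientAt hr).gradient

namespace Admissible

theorem continuousOn_right (h : Admissible c X Y) {x : 𝔼 n} (hx : x ∈ X) :
    ContinuousOn (fun y => c x y) (closure Y) :=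
  h.continuousOn.comp (f := fun y => (x, y)) (by fun_prop) fun _ hy => ⟨hx, hy⟩

theorem isCompact_closure (h : Admissible c X Y) : IsCompact (closure Y) :=
  h.isBounded.isCompact_closure

theorem tendsto_cost (h : Admissible c X Y) {x y : 𝔼 n} {u v : ℕ → 𝔼 n} (hx : x ∈ X)
    (hy : y ∈ closure Y) (hu : ∀ k, u k ∈ X) (hv : ∀ k, v k ∈ closure Y)
    (hux : Tendsto u atTop (𝓝 x)) (hvy : Tendsto v atTop (𝓝 y)) :
    Tendsto (fun k => c (u k) (v k)) atTop (𝓝 (c x y)) := by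
  have h1 := h.continuousOn (x, y) ⟨hx, hy⟩
  exact h1.tendsto.comp (tendsto_nhdsWithin_iff.2
    ⟨hux.prodMk_nhds hvy, Eventually.of_forall fun k => ⟨hu k, hv k⟩⟩)

/-- An expansion with a uniform constant survives limits in `y` and in the slope. Since it also
determines the gradient, it is the means of differentiating `c(·, y)` for `y` on the boundary, where
only continuity of `c` is assumed. -/
theorem quadBound_of_tendsto (h : Admissible c X Y) {M r : ℝ} {x y G : 𝔼 n} {v g : ℕ → 𝔼 n}
    (hr : 0 < r) (hball : Metric.ball x r ⊆ X) (hy : y ∈ closure Y) (hv : ∀ k, v k ∈ closure Y)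
    (hvy : Tendsto v atTop (𝓝 y)) (hg : Tendsto g atTop (𝓝 G))
    (hb : ∀ k, QuadBound c M r x (v k) (g k)) : QuadBound c M r x y G := by
  intro x' hx'
  have hc : ∀ z ∈ X, Tendsto (fun k => c z (v k)) atTop (𝓝 (c z y)) := fun z hz =>
    h.tendsto_cost hz hy (fun _ => hz) hv tendsto_const_nhds hvy
  refine le_of_tendsto (((hc x' (hball hx')).sub (hc x (hball (Metric.mem_ball_self hr)))).sub
    (hg.inner tendsto_const_nhds)).abs (Eventually.of_forall fun k => hb k x' hx')

theorem exists_bound (h : Admissible c X Y) : ∃ M : ℝ, 0 ≤ M ∧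
    (∀ x ∈ X, ∀ y ∈ closure Y, |c x y| ≤ M) ∧
    (∀ x ∈ X, ∀ y ∈ closure Y, ‖gradX c x y‖ ≤ M) ∧
    (∀ x r, 0 < r → Metric.ball x r ⊆ X → ∀ y ∈ closure Y, QuadBound c M r x y (gradX c x y)) ∧
    (∀ x r, 0 < r → Metric.ball x r ⊆ X → ∀ y ∈ Y, ∀ x' ∈ Metric.ball x r,
      ‖gradX c x' y - gradX c x y‖ ≤ M * ‖x' - x‖) := by
  obtain ⟨M, hM⟩ := h.condC0.2
  set U := Function.uncurry c with hU
  have hM0 : 0 ≤ max M 0 := le_max_right _ _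
  have hbd1 : ∀ x ∈ X, ∀ y ∈ Y, ‖gradX c x y‖ ≤ max M 0 := by
    intro x hx y hy
    rw [h.gradX_eq hx hy, LinearIsometryEquiv.norm_map]
    have h1 := hM 1 (by norm_num) (x, y) ⟨hx, hy⟩
    rw [norm_iteratedFDeriv_one] at h1
    calc _ ≤ ‖fderiv ℝ U (x, y)‖ * ‖ContinuousLinearMap.inl ℝ (𝔼 n) (𝔼 n)‖ :=
          ContinuousLinearMap.opNorm_comp_le _ _
      _ ≤ M * 1 := mul_le_mul h1 (ContinuousLinearMap.norm_inl_le_one ℝ _ _) (norm_nonneg _)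
          ((norm_nonneg _).trans h1)
      _ ≤ max M 0 := by rw [mul_one]; exact le_max_left _ _
  have hlip : ∀ x r, 0 < r → Metric.ball x r ⊆ X → ∀ y ∈ Y, ∀ x' ∈ Metric.ball x r,
      ‖gradX c x' y - gradX c x y‖ ≤ max M 0 * ‖x' - x‖ := by
    intro x r hr hball y hy x' hx'
    have hx : x ∈ Metric.ball x r := Metric.mem_ball_self hr
    rw [h.gradX_eq (hball hx') hy, h.gradX_eq (hball hx) hy, ← map_sub,
      LinearIsometryEquiv.norm_map, ← ContinuousLinearMap.sub_comp]
    have hd : ∀ z ∈ Metric.ball x r ×ˢ {y}, DifferentiableAt ℝ (fderiv ℝ U) z := by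
      rintro ⟨a, b⟩ ⟨ha, rfl⟩
      exact ((h.contDiffAt (hball ha) hy).fderiv_right (m := 1) (by norm_num)).differentiableAt
        (by norm_num)
    have h1 : ‖fderiv ℝ U (x', y) - fderiv ℝ U (x, y)‖ ≤ M * ‖(x', y) - (x, y)‖ := by
      refine Convex.norm_image_sub_le_of_norm_fderiv_le (𝕜 := ℝ) (s := Metric.ball x r ×ˢ {y}) hd
        ?_ ((convex_ball x r).prod (convex_singleton y)) ⟨hx, rfl⟩ ⟨hx', rfl⟩
      rintro ⟨a, b⟩ ⟨ha, rfl⟩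
      rw [← norm_iteratedFDeriv_one, norm_iteratedFDeriv_fderiv]
      exact hM 2 (by norm_num) _ ⟨hball ha, hy⟩
    have h2 : ‖(x', y) - (x, y)‖ = ‖x' - x‖ := by simp [Prod.norm_def]
    rw [h2] at h1
    calc _ ≤ ‖fderiv ℝ U (x', y) - fderiv ℝ U (x, y)‖ * ‖ContinuousLinearMap.inl ℝ (𝔼 n) (𝔼 n)‖ :=
          ContinuousLinearMap.opNorm_comp_le _ _
      _ ≤ (M * ‖x' - x‖) * 1 := mul_le_mul h1 (ContinuousLinearMap.norm_inl_le_one ℝ _ _)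
          (norm_nonneg _) ((norm_nonneg _).trans h1)
      _ ≤ max M 0 * ‖x' - x‖ := by
          rw [mul_one]; exact mul_le_mul_of_nonneg_right (le_max_left _ _) (norm_nonneg _)
  have hquad : ∀ x r, 0 < r → Metric.ball x r ⊆ X → ∀ y ∈ Y,
      QuadBound c (max M 0) r x y (gradX c x y) := by
    intro x r hr hball y hy x' hx'
    have hsub : segment ℝ x x' ⊆ Metric.ball x r :=
      (convex_ball x r).segment_subset (Metric.mem_ball_self hr) hx'
    have hseg : ∀ z ∈ segment ℝ x x', ‖z - x‖ ≤ ‖x' - x‖ := by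
      rintro z ⟨a, b, ha, hb, hab, rfl⟩
      have : a • x + b • x' - x = b • (x' - x) := by
        rw [eq_sub_of_add_eq hab]; module
      rw [this, norm_smul, Real.norm_of_nonneg hb]
      exact mul_le_of_le_one_left (norm_nonneg _) (by linarith)
    have := Convex.norm_image_sub_le_of_norm_hasFDerivWithin_le' (𝕜 := ℝ)
      (f := fun x' => c x' y) (s := segment ℝ x x') (x := x) (y := x')
      (f' := fun z => InnerProductSpace.toDual ℝ (𝔼 n) (gradX c z y))
      (φ := InnerProductSpace.toDual ℝ (𝔼 n) (gradX c x y)) (C := max M 0 * ‖x' - x‖)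
      (fun z hz => by
        have hz := h.hasFDerivAt_left (hball (hsub hz)) hy
        rw [gradX, gradient, LinearIsometryEquiv.apply_symm_apply]
        exact hz.differentiableAt.hasFDerivAt.hasFDerivWithinAt)
      (fun z hz => by
        rw [← map_sub, LinearIsometryEquiv.norm_map]
        exact (hlip x r hr hball y hy z (hsub hz)).trans
          (mul_le_mul_of_nonneg_left (hseg z hz) hM0))
      (convex_segment x x') (left_mem_segment ℝ x x') (right_mem_segment ℝ x x')
    rw [Real.norm_eq_abs, InnerProductSpace.toDual_apply_apply] at this
    linarith [this]
  -- Gradients at interior points are bounded, so along a sequence tending to `y` they subconverge,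
  -- and the limit is the gradient at `y`.
  have hcl : ∀ x r, 0 < r → Metric.ball x r ⊆ X → ∀ y ∈ closure Y,
      ∃ G, ‖G‖ ≤ max M 0 ∧ QuadBound c (max M 0) r x y G := by
    intro x r hr hball y hy
    obtain ⟨v, hv, hvy⟩ := mem_closure_iff_seq_limit.1 hy
    have hx : x ∈ X := hball (Metric.mem_ball_self hr)
    obtain ⟨G, hG, φ, hφ, hlim⟩ := (isCompact_closedBall (0 : 𝔼 n) (max M 0)).tendsto_subseq
      (x := fun k => gradX c x (v k)) (fun k => by simpa using hbd1 x hx _ (hv k))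
    refine ⟨G, by simpa using hG, ?_⟩
    exact h.quadBound_of_tendsto hr hball hy (fun k => subset_closure (hv (φ k)))
      (hvy.comp hφ.tendsto_atTop) hlim (fun k => hquad x r hr hball _ (hv (φ k)))
  refine ⟨max M 0, hM0, ?_, ?_, ?_, hlip⟩
  · intro x hx y hy
    refine le_on_closure (f := fun y => |c x y|) (g := fun _ => max M 0) ?_
      (h.continuousOn_right hx).abs continuousOn_const hy
    intro y hy
    have := hM 0 (by norm_num) (x, y) ⟨hx, hy⟩
    rw [norm_iteratedFDeriv_zero] at this
    exact this.trans (le_max_left _ _)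
  · intro x hx y hy
    obtain ⟨r, hr, hball⟩ := Metric.isOpen_iff.1 h.isOpen_left x hx
    obtain ⟨G, hG, hq⟩ := hcl x r hr hball y hy
    rwa [hq.gradX_eq hr]
  · intro x r hr hball y hy
    obtain ⟨G, hG, hq⟩ := hcl x r hr hball y hy
    rwa [hq.gradX_eq hr]

/-- Bounded gradients subconverge, and any limit satisfies the quadratic expansion at the limit
point `y`, so it can only be `gradX c x y`. -/
theorem continuousOn_gradX (h : Admissible c X Y) {x : 𝔼 n} (hx : x ∈ X) :
    ContinuousOn (gradX c x) (closure Y) := by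
  obtain ⟨M, hM0, -, hgb, hq, -⟩ := h.exists_bound
  obtain ⟨r, hr, hball⟩ := Metric.isOpen_iff.1 h.isOpen_left x hx
  intro y hy
  refine tendsto_of_subseq_tendsto fun v hv => ?_
  rw [tendsto_nhdsWithin_iff] at hv
  obtain ⟨N, hN⟩ := eventually_atTop.1 hv.2
  have hv2 : ∀ k, v (k + N) ∈ closure Y := fun k => hN _ (Nat.le_add_left _ _)
  obtain ⟨G, hG, φ, hφ, hlim⟩ := (isCompact_closedBall (0 : 𝔼 n) M).tendsto_subseq
      (x := fun k => gradX c x (v (k + N))) (fun k => by simpa using hgb x hx _ (hv2 k))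
  have hqG : QuadBound c M r x y G :=
    h.quadBound_of_tendsto hr hball hy (fun k => hv2 (φ k))
      (hv.1.comp ((tendsto_add_atTop_nat N).comp hφ.tendsto_atTop)) hlim
      (fun k => hq x r hr hball _ (hv2 _))
  refine ⟨fun k => φ k + N, ?_⟩
  rw [hqG.gradX_eq hr]
  exact hlim

theorem norm_gradX_sub_le (h : Admissible c X Y) : ∃ M : ℝ, ∀ x r, 0 < r →
    Metric.ball x r ⊆ X → ∀ y ∈ closure Y, ∀ x' ∈ Metric.ball x r,
      ‖gradX c x' y - gradX c x y‖ ≤ M * ‖x' - x‖ := by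
  obtain ⟨M, -, -, -, -, hl⟩ := h.exists_bound
  refine ⟨M, fun x r hr hball y hy x' hx' => ?_⟩
  refine le_on_closure (f := fun y => ‖gradX c x' y - gradX c x y‖)
    (g := fun _ => M * ‖x' - x‖) (fun y hy => hl x r hr hball y hy x' hx') ?_
      continuousOn_const hy
  exact ((h.continuousOn_gradX (hball hx')).sub
    (h.continuousOn_gradX (hball (Metric.mem_ball_self hr)))).norm

end Admissible

/-! ### The `c`-exponential map and `c`-segments. -/

/-- A map with invertible derivative at a point of an open set on which it has a left inverse `g`
covers a neighbourhood of the image point, and `g` is as smooth as the map there. -/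
theorem image_mem_nhds_and_contDiffAt_leftInverse {E F : Type*} [NormedAddCommGroup E]
    [NormedSpace ℝ E] [CompleteSpace E] [NormedAddCommGroup F] [NormedSpace ℝ F]
    {f : E → F} {g : F → E} {Ω : Set E} {k : WithTop ℕ∞} (hk : k ≠ 0) (hΩ : IsOpen Ω) {x : E}
    (hx : x ∈ Ω) (hf : ContDiffAt ℝ k f x) {f' : E ≃L[ℝ] F}
    (hf' : HasFDerivAt f (f' : E →L[ℝ] F) x) (hg : ∀ z ∈ Ω, g (f z) = z) :
    f '' Ω ∈ 𝓝 (f x) ∧ ContDiffAt ℝ k g (f x) := by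
  have hs : HasStrictFDerivAt f (f' : E →L[ℝ] F) x := hf.hasStrictFDerivAt' hf' hk
  refine ⟨?_, ?_⟩
  · have := hs.map_nhds_eq_of_equiv
    rw [← this]
    exact image_mem_map (hΩ.mem_nhds hx)
  · refine (hf.to_localInverse hf' hk).congr_of_eventuallyEq ?_
    -- The local inverse of the inverse function theorem takes values in `Ω` near `f x`, where `g`
    -- undoes `f`; hence the two agree.
    have h1 := hs.eventually_right_inverse
    have h2 := hs.localInverse_continuousAt
    have h3 : ∀ᶠ p in 𝓝 (f x), hs.localInverse f f' x p ∈ Ω :=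
      h2.eventually (by rw [hs.localInverse_apply_image]; exact hΩ.mem_nhds hx)
    filter_upwards [h1, h3] with p hp1 hp2
    calc g p = g (f (hs.localInverse f f' x p)) := by rw [hp1]
      _ = _ := hg _ hp2

namespace Admissible

theorem contDiffAt_gradX (h : Admissible c X Y) {x y : 𝔼 n} (hx : x ∈ X) (hy : y ∈ Y) :
    ContDiffAt ℝ 3 (fun z : (𝔼 n) × (𝔼 n) => gradX c z.1 z.2) (x, y) := by
  have h1 : ContDiffAt ℝ 3 (fderiv ℝ (Function.uncurry c)) (x, y) :=
    (h.contDiffAt hx hy).fderiv_right (by norm_num)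
  have h2 : ContDiffAt ℝ 3 (fun z : (𝔼 n) × (𝔼 n) => (InnerProductSpace.toDual ℝ (𝔼 n)).symm
      ((fderiv ℝ (Function.uncurry c) z).comp (ContinuousLinearMap.inl ℝ (𝔼 n) (𝔼 n)))) (x, y) :=
    (LinearIsometryEquiv.contDiff _).contDiffAt.comp _ (h1.clm_comp contDiffAt_const)
  refine h2.congr_of_eventuallyEq ?_
  filter_upwards [(h.isOpen_left.prod h.isOpen_right).mem_nhds (x := (x, y)) ⟨hx, hy⟩] with z hz
  exact h.gradX_eq hz.1 hz.2

theorem contDiffAt_gradY (h : Admissible c X Y) {x y : 𝔼 n} (hx : x ∈ X) (hy : y ∈ Y) :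
    ContDiffAt ℝ 3 (fun z : (𝔼 n) × (𝔼 n) => gradY c z.1 z.2) (x, y) := by
  have h1 : ContDiffAt ℝ 3 (fderiv ℝ (Function.uncurry c)) (x, y) :=
    (h.contDiffAt hx hy).fderiv_right (by norm_num)
  have h2 : ContDiffAt ℝ 3 (fun z : (𝔼 n) × (𝔼 n) => (InnerProductSpace.toDual ℝ (𝔼 n)).symm
      ((fderiv ℝ (Function.uncurry c) z).comp (ContinuousLinearMap.inr ℝ (𝔼 n) (𝔼 n)))) (x, y) :=
    (LinearIsometryEquiv.contDiff _).contDiffAt.comp _ (h1.clm_comp contDiffAt_const)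
  refine h2.congr_of_eventuallyEq ?_
  filter_upwards [(h.isOpen_left.prod h.isOpen_right).mem_nhds (x := (x, y)) ⟨hx, hy⟩] with z hz
  exact h.gradY_eq hz.1 hz.2

theorem contDiffAt_gradX_right (h : Admissible c X Y) {x y : 𝔼 n} (hx : x ∈ X) (hy : y ∈ Y) :
    ContDiffAt ℝ 3 (gradX c x) y :=
  (h.contDiffAt_gradX hx hy).comp (f := fun y => (x, y)) y (contDiffAt_const.prodMk contDiffAt_id)

theorem injective_fderiv_gradX (h : Admissible c X Y) {x y : 𝔼 n} (hx : x ∈ X) (hy : y ∈ Y) :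
    Function.Injective (fderiv ℝ (gradX c x) y) := by
  have h1 : LinearMap.det (fderiv ℝ (gradX c x) y : (𝔼 n) →ₗ[ℝ] (𝔼 n)) ≠ 0 :=
    h.condC3 x hx y hy
  exact (LinearMap.equivOfDetNeZero _ h1).injective

theorem surjective_fderiv_gradX (h : Admissible c X Y) {x y : 𝔼 n} (hx : x ∈ X) (hy : y ∈ Y) :
    Function.Surjective (fderiv ℝ (gradX c x) y) :=
  LinearMap.surjective_of_injective (f := (fderiv ℝ (gradX c x) y : (𝔼 n) →ₗ[ℝ] (𝔼 n)))
    (h.injective_fderiv_gradX hx hy)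

theorem injOn_neg_gradX (h : Admissible c X Y) {x : 𝔼 n} (hx : x ∈ X) :
    InjOn (fun y => -gradX c x y) Y := h.condC1 x hx

theorem cExp_neg_gradX (h : Admissible c X Y) {x y : 𝔼 n} (hx : x ∈ X) (hy : y ∈ Y) :
    cExp c Y x (-gradX c x y) = y :=
  (h.injOn_neg_gradX hx).leftInvOn_invFunOn hy

/-- (C3) provides a local C³ inverse and (C1) identifies it with the globally chosen inverse `cExp`.
-/
theorem image_gradX_mem_nhds_and_contDiffAt_cExp (h : Admissible c X Y) {x y : 𝔼 n}
    (hx : x ∈ X) (hy : y ∈ Y) : (fun y => -gradX c x y) '' Y ∈ 𝓝 (-gradX c x y) ∧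
      ContDiffAt ℝ 3 (cExp c Y x) (-gradX c x y) := by
  have hinj : Function.Injective (-fderiv ℝ (gradX c x) y) := fun a b hab =>
    h.injective_fderiv_gradX hx hy (neg_injective hab)
  have hd : HasFDerivAt (fun y => -gradX c x y) (-fderiv ℝ (gradX c x) y) y :=
    ((h.contDiffAt_gradX_right hx hy).differentiableAt (by norm_num)).hasFDerivAt.neg
  exact image_mem_nhds_and_contDiffAt_leftInverse (f := fun y => -gradX c x y) (k := 3)
    (by norm_num) h.isOpen_right hy (h.contDiffAt_gradX_right hx hy).neg
    (f' := (LinearEquiv.ofInjectiveEndo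
      (-fderiv ℝ (gradX c x) y : (𝔼 n) →L[ℝ] (𝔼 n)).toLinearMap hinj).toContinuousLinearEquiv)
    hd (fun z hz => h.cExp_neg_gradX hx hz)

theorem cExp_mem (h : Admissible c X Y) {x p : 𝔼 n} (hx : x ∈ X)
    (hp : p ∈ (fun y => -gradX c x y) '' Y) : cExp c Y x p ∈ Y ∧ -gradX c x (cExp c Y x p) = p := by
  obtain ⟨y, hy, rfl⟩ := hp
  simp only [h.cExp_neg_gradX hx hy, hy, and_self]

theorem contDiffAt_cExp (h : Admissible c X Y) {x p : 𝔼 n} (hx : x ∈ X)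
    (hp : p ∈ (fun y => -gradX c x y) '' Y) : ContDiffAt ℝ 3 (cExp c Y x) p := by
  obtain ⟨y, hy, rfl⟩ := hp
  exact (h.image_gradX_mem_nhds_and_contDiffAt_cExp hx hy).2

theorem isOpen_image_gradX (h : Admissible c X Y) {x : 𝔼 n} (hx : x ∈ X) :
    IsOpen ((fun y => -gradX c x y) '' Y) := by
  rw [isOpen_iff_mem_nhds]
  rintro _ ⟨y, hy, rfl⟩
  exact (h.image_gradX_mem_nhds_and_contDiffAt_cExp hx hy).1

theorem convex_image_neg_gradX (h : Admissible c X Y) {x : 𝔼 n} (hx : x ∈ X) :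
    Convex ℝ ((fun y => -gradX c x y) '' Y) := by
  have := (h.convex x hx).neg
  rwa [← image_neg_eq_neg, image_image] at this

theorem cSegIn (h : Admissible c X Y) {x y₀ y₁ : 𝔼 n} (hx : x ∈ X) (h₀ : y₀ ∈ Y) (h₁ : y₁ ∈ Y) :
    CSegIn c Y x y₀ y₁ := fun t ht =>
  h.convex_image_neg_gradX hx (mem_image_of_mem _ h₀) (mem_image_of_mem _ h₁) (by linarith [ht.2])
    ht.1 (by ring)

theorem cSeg_mem (h : Admissible c X Y) {x y₀ y₁ : 𝔼 n} (hx : x ∈ X) (h₀ : y₀ ∈ Y) (h₁ : y₁ ∈ Y)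
    {t : ℝ} (ht : t ∈ Icc (0 : ℝ) 1) : cSeg c Y x y₀ y₁ t ∈ Y :=
  (h.cExp_mem hx (h.cSegIn hx h₀ h₁ t ht)).1

theorem neg_gradX_cSeg (h : Admissible c X Y) {x y₀ y₁ : 𝔼 n} (hx : x ∈ X) (h₀ : y₀ ∈ Y)
    (h₁ : y₁ ∈ Y) {t : ℝ} (ht : t ∈ Icc (0 : ℝ) 1) :
    -gradX c x (cSeg c Y x y₀ y₁ t) = pSeg c x y₀ y₁ t :=
  (h.cExp_mem hx (h.cSegIn hx h₀ h₁ t ht)).2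

theorem continuousOn_cSeg (h : Admissible c X Y) {x y₀ y₁ : 𝔼 n} (hx : x ∈ X) (h₀ : y₀ ∈ Y)
    (h₁ : y₁ ∈ Y) : ContinuousOn (cSeg c Y x y₀ y₁) (Icc 0 1) := by
  intro t ht
  refine ContinuousAt.continuousWithinAt ?_
  refine ContinuousAt.comp (f := pSeg c x y₀ y₁) (g := cExp c Y x)
    (h.contDiffAt_cExp hx (h.cSegIn hx h₀ h₁ t ht)).continuousAt ?_
  unfold pSeg
  fun_prop

theorem cSeg_zero (h : Admissible c X Y) {x y₀ y₁ : 𝔼 n} (hx : x ∈ X) (h₀ : y₀ ∈ Y) :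
    cSeg c Y x y₀ y₁ 0 = y₀ := by
  simp [cSeg, pSeg, h.cExp_neg_gradX hx h₀]

theorem cSeg_one (h : Admissible c X Y) {x y₀ y₁ : 𝔼 n} (hx : x ∈ X) (h₁ : y₁ ∈ Y) :
    cSeg c Y x y₀ y₁ 1 = y₁ := by
  simp [cSeg, pSeg, h.cExp_neg_gradX hx h₁]

/-- A boundary point of `Y` is not sent by `D_x c(x, ·)` to the image of a point of `Y`. -/
theorem eq_of_gradX_eq (h : Admissible c X Y) {x y y' : 𝔼 n} (hx : x ∈ X) (hy : y ∈ closure Y)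
    (hy' : y' ∈ Y) (heq : gradX c x y = gradX c x y') : y = y' := by
  obtain ⟨v, hv, hvy⟩ := mem_closure_iff_seq_limit.1 hy
  have h1 : Tendsto (fun k => -gradX c x (v k)) atTop (𝓝 (-gradX c x y')) := by
    rw [← heq]
    exact ((h.continuousOn_gradX hx y hy).tendsto.comp (tendsto_nhdsWithin_iff.2
      ⟨hvy, Eventually.of_forall fun k => subset_closure (hv k)⟩)).neg
  -- `cExp` is continuous at the image of the interior point `y'`, so `v k`, recovered from its
  -- gradient, tends to `y'` as well as to `y`.
  have h2 := (h.contDiffAt_cExp hx (mem_image_of_mem _ hy')).continuousAt.tendsto.comp h1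
  simp only [Function.comp_def, h.cExp_neg_gradX hx (hv _), h.cExp_neg_gradX hx hy'] at h2
  exact tendsto_nhds_unique hvy h2

end Admissible

/-! ### `c`-convex functions and their subdifferentials. -/

/-- The `c`-subdifferential of a real-valued function. -/
def realSubdiff (c : (𝔼 n) → (𝔼 n) → ℝ) (X Y : Set (𝔼 n)) (f : (𝔼 n) → ℝ) (x : 𝔼 n) : Set (𝔼 n) :=
  {y | y ∈ closure Y ∧ ∀ z ∈ X, f x + c x y - c z y ≤ f z}

theorem cSubdiff_eq_realSubdiff {ψ : (𝔼 n) → EReal} {f : (𝔼 n) → ℝ}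
    (hf : ∀ x ∈ X, ψ x = (f x : EReal)) {x : 𝔼 n} (hx : x ∈ X) :
    cSubdiff c X Y ψ x = realSubdiff c X Y f x := by
  ext y
  refine and_congr_right fun _ => forall₂_congr fun z hz => ?_
  rw [hf x hx, hf z hz, ← EReal.coe_add, EReal.coe_le_coe_iff]
  constructor <;> intro h <;> linarith

theorem mem_frechetSubdiff_iff (hX : IsOpen X) {ψ : (𝔼 n) → EReal} {f : (𝔼 n) → ℝ}
    (hf : ∀ x ∈ X, ψ x = (f x : EReal)) {x : 𝔼 n} (hx : x ∈ X) {p : 𝔼 n} :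
    p ∈ frechetSubdiff X ψ x ↔ ∀ ε : ℝ, 0 < ε → ∀ᶠ z in 𝓝 x,
      f x + (inner ℝ p (z - x) - ε * ‖z - x‖) ≤ f z := by
  refine forall₂_congr fun ε _ => ?_
  rw [hX.nhdsWithin_eq hx]
  refine eventually_congr ?_
  filter_upwards [hX.mem_nhds hx] with z hz
  rw [hf x hx, hf z hz, ← EReal.coe_add, EReal.coe_le_coe_iff]

/-- A supporting point taken in `Y` itself, not merely in `closure Y`, attains the supremum in the
definition. -/
theorem isCConvex_coe {f : (𝔼 n) → ℝ} (hne : X.Nonempty)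
    (hf : ∀ x ∈ X, ∃ y ∈ Y, ∀ z ∈ X, f x + c x y - c z y ≤ f z) :
    IsCConvex c X Y (fun x => (f x : EReal)) := by
  refine ⟨fun x _ => EReal.coe_ne_bot _, ?_, fun x hx => le_antisymm ?_ ?_⟩
  · exact hne.imp fun x hx => ⟨hx, EReal.coe_ne_top _⟩
  · obtain ⟨y, hy, hz⟩ := hf x hx
    refine le_trans ?_ (le_iSup₂ (f := fun y (_ : y ∈ Y) =>
      cTransform c X (fun x => (f x : EReal)) y - (c x y : EReal)) y hy)
    have h1 : ((f x + c x y : ℝ) : EReal) ≤ cTransform c X (fun x => (f x : EReal)) y := by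
      refine le_iInf₂ fun z hzX => ?_
      rw [← EReal.coe_add, EReal.coe_le_coe_iff]
      linarith [hz z hzX]
    calc (f x : EReal) = ((f x + c x y : ℝ) : EReal) - (c x y : EReal) := by
          rw [← EReal.coe_sub]; simp
      _ ≤ _ := EReal.sub_le_sub h1 le_rfl
  · refine iSup₂_le fun y hy => ?_
    have h1 : cTransform c X (fun x => (f x : EReal)) y ≤ ((f x + c x y : ℝ) : EReal) :=
      (iInf₂_le x hx).trans_eq (EReal.coe_add _ _).symm
    calc _ ≤ ((f x + c x y : ℝ) : EReal) - (c x y : EReal) := EReal.sub_le_sub h1 le_rfl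
      _ = _ := by rw [← EReal.coe_sub]; simp

namespace Admissible

theorem exists_real (h : Admissible c X Y) {ψ : (𝔼 n) → EReal} (hψ : IsCConvex c X Y ψ) :
    ∃ f : (𝔼 n) → ℝ, ∀ x ∈ X, ψ x = (f x : EReal) := by
  obtain ⟨M, hM0, hM, -⟩ := h.exists_bound
  obtain ⟨hbot, ⟨x₀, hx₀, htop⟩, heq⟩ := hψ
  have h0 : ((ψ x₀).toReal : EReal) = ψ x₀ := EReal.coe_toReal htop (hbot x₀ hx₀)
  refine ⟨fun x => (ψ x).toReal, fun x hx => (EReal.coe_toReal ?_ (hbot x hx)).symm⟩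
  -- One finite value `ψ x₀` bounds `ψ` everywhere, because `c` oscillates by at most `2 * M`.
  refine ne_of_lt (lt_of_le_of_lt (b := (((ψ x₀).toReal + 2 * M : ℝ) : EReal)) ?_
    (EReal.coe_lt_top _))
  rw [heq x hx]
  refine iSup₂_le fun y hy => ?_
  have h1 : cTransform c X ψ y ≤ (((ψ x₀).toReal + c x₀ y : ℝ) : EReal) := by
    refine (iInf₂_le x₀ hx₀).trans_eq ?_
    rw [EReal.coe_add, h0]
  refine (EReal.sub_le_sub h1 le_rfl).trans ?_
  rw [← EReal.coe_sub, EReal.coe_le_coe_iff]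
  have h2 := abs_le.1 (hM x₀ hx₀ y (subset_closure hy))
  have h3 := abs_le.1 (hM x hx y (subset_closure hy))
  linarith [h2.2, h3.1]

/-- The supremum over the open set `Y` need not be attained. Points attaining it up to `1 / (k + 1)`
accumulate in `closure Y`, and the support inequality passes to the limit. -/
theorem nonempty_realSubdiff (h : Admissible c X Y) {ψ : (𝔼 n) → EReal} (hψ : IsCConvex c X Y ψ)
    {f : (𝔼 n) → ℝ} (hf : ∀ x ∈ X, ψ x = (f x : EReal)) {x : 𝔼 n} (hx : x ∈ X) :
    (realSubdiff c X Y f x).Nonempty := by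
  have key : ∀ k : ℕ, ∃ y ∈ Y, ∀ z ∈ X, f x - 1 / ((k : ℝ) + 1) ≤ f z + c z y - c x y := by
    intro k
    have h1 : ((f x - 1 / ((k : ℝ) + 1) : ℝ) : EReal) < ψ x := by
      rw [hf x hx, EReal.coe_lt_coe_iff]
      linarith [Nat.one_div_pos_of_nat (α := ℝ) (n := k)]
    rw [hψ.2.2 x hx, lt_iSup_iff] at h1
    obtain ⟨y, h1⟩ := h1
    obtain ⟨hy, h1⟩ := lt_iSup_iff.1 h1
    refine ⟨y, hy, fun z hz => ?_⟩
    have h2 : cTransform c X ψ y ≤ ((f z + c z y : ℝ) : EReal) := by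
      refine (iInf₂_le z hz).trans_eq ?_
      rw [EReal.coe_add, hf z hz]
    have h3 := h1.le.trans (EReal.sub_le_sub h2 le_rfl)
    rwa [← EReal.coe_sub, EReal.coe_le_coe_iff] at h3
  choose v hv hvz using key
  obtain ⟨y, hy, φ, hφ, hlim⟩ := h.isCompact_closure.tendsto_subseq
    (fun k => subset_closure (hv k))
  refine ⟨y, hy, fun z hz => ?_⟩
  have hc : ∀ z ∈ X, Tendsto (fun k => c z (v (φ k))) atTop (𝓝 (c z y)) := fun z hz =>
    h.tendsto_cost hz hy (fun _ => hz) (fun k => subset_closure (hv _)) tendsto_const_nhds hlim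
  have h1 : Tendsto (fun k => f x - 1 / ((φ k : ℝ) + 1)) atTop (𝓝 (f x - 0)) :=
    tendsto_const_nhds.sub (tendsto_one_div_add_atTop_nhds_zero_nat.comp hφ.tendsto_atTop)
  have h2 := le_of_tendsto_of_tendsto' h1
    (((tendsto_const_nhds (x := f z)).add (hc z hz)).sub (hc x hx)) (fun k => hvz (φ k) z hz)
  linarith

/-- The graph of the `c`-subdifferential is closed. -/
theorem mem_realSubdiff_of_tendsto (h : Admissible c X Y) {f : (𝔼 n) → ℝ} {x y : 𝔼 n}
    {u v : ℕ → 𝔼 n} (hx : x ∈ X) (hne : (realSubdiff c X Y f x).Nonempty) (hu : ∀ k, u k ∈ X)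
    (hv : ∀ k, v k ∈ realSubdiff c X Y f (u k)) (hux : Tendsto u atTop (𝓝 x))
    (hvy : Tendsto v atTop (𝓝 y)) : y ∈ realSubdiff c X Y f x := by
  have hy : y ∈ closure Y :=
    isClosed_closure.mem_of_tendsto hvy (Eventually.of_forall fun k => (hv k).1)
  refine ⟨hy, fun z hz => ?_⟩
  -- Continuity of `f` has not been established. A `c`-subgradient `w` at `x` bounds `f (u k)` below
  -- by a quantity tending to `f x`, and this semicontinuity is enough.
  obtain ⟨w, hw, hwz⟩ := hne
  have h1 := h.tendsto_cost hx hw hu (fun _ => hw) hux tendsto_const_nhds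
  have h2 := h.tendsto_cost hx hy hu (fun k => (hv k).1) hux hvy
  have h3 := h.tendsto_cost hz hy (fun _ => hz) (fun k => (hv k).1) tendsto_const_nhds hvy
  have h4 := le_of_tendsto_of_tendsto'
    (((((tendsto_const_nhds (x := f x + c x w)).sub h1).add h2).sub h3))
    (tendsto_const_nhds (x := f z))
    (fun k => by linarith [hwz (u k) (hu k), (hv k).2 z hz])
  linarith

theorem isCompact_realSubdiff (h : Admissible c X Y) {f : (𝔼 n) → ℝ} {x : 𝔼 n} (hx : x ∈ X) :
    IsCompact (realSubdiff c X Y f x) := by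
  refine h.isCompact_closure.of_isClosed_subset ?_ fun y hy => hy.1
  refine IsSeqClosed.isClosed fun v y hv hvy => ?_
  exact h.mem_realSubdiff_of_tendsto hx ⟨v 0, hv 0⟩ (fun _ => hx) hv tendsto_const_nhds hvy

theorem isCompact_image_realSubdiff (h : Admissible c X Y) {f : (𝔼 n) → ℝ} {x : 𝔼 n}
    (hx : x ∈ X) : IsCompact ((fun y => -gradX c x y) '' realSubdiff c X Y f x) :=
  (h.isCompact_realSubdiff hx).image_of_continuousOn
    ((h.continuousOn_gradX hx).neg.mono fun _ hy => hy.1)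

theorem tendsto_gradX (h : Admissible c X Y) {x y : 𝔼 n} (hx : x ∈ X) (hy : y ∈ closure Y)
    {v : ℕ → 𝔼 n} (hv : ∀ k, v k ∈ closure Y) (hvy : Tendsto v atTop (𝓝 y)) :
    Tendsto (fun k => gradX c x (v k)) atTop (𝓝 (gradX c x y)) :=
  (h.continuousOn_gradX hx y hy).tendsto.comp (tendsto_nhdsWithin_iff.2
    ⟨hvy, Eventually.of_forall hv⟩)

theorem image_subset_frechetSubdiff (h : Admissible c X Y) {ψ : (𝔼 n) → EReal} {f : (𝔼 n) → ℝ}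
    (hf : ∀ x ∈ X, ψ x = (f x : EReal)) {x : 𝔼 n} (hx : x ∈ X) :
    (fun y => -gradX c x y) '' realSubdiff c X Y f x ⊆ frechetSubdiff X ψ x := by
  obtain ⟨M, hM0, -, -, hq, -⟩ := h.exists_bound
  obtain ⟨r, hr, hball⟩ := Metric.isOpen_iff.1 h.isOpen_left x hx
  rintro _ ⟨y, hy, rfl⟩
  rw [mem_frechetSubdiff_iff h.isOpen_left hf hx]
  intro ε hε
  have hd := (hq x r hr hball y hy.1).hasGradientAt hr
  rw [hasGradientAt_iff_hasFDerivAt, hasFDerivAt_iff_isLittleO] at hd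
  filter_upwards [h.isOpen_left.mem_nhds hx, hd.bound hε] with z hz hb
  have h1 := hy.2 z hz
  rw [InnerProductSpace.toDual_apply_apply, Real.norm_eq_abs] at hb
  have h2 := (abs_le.1 hb).2
  rw [inner_neg_left]
  linarith

/-- Directional bound for Fréchet subgradients by `c`-subgradients. -/
theorem exists_inner_le (h : Admissible c X Y) {ψ : (𝔼 n) → EReal} {f : (𝔼 n) → ℝ}
    (hf : ∀ x ∈ X, ψ x = (f x : EReal)) (hne : ∀ x ∈ X, (realSubdiff c X Y f x).Nonempty)
    {x : 𝔼 n} (hx : x ∈ X) {p : 𝔼 n} (hp : p ∈ frechetSubdiff X ψ x) (v : 𝔼 n) :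
    ∃ y ∈ realSubdiff c X Y f x, inner ℝ p v ≤ inner ℝ (-gradX c x y) v := by
  obtain ⟨M, hM0, -, -, hq, -⟩ := h.exists_bound
  obtain ⟨r, hr, hball⟩ := Metric.isOpen_iff.1 h.isOpen_left x hx
  rw [mem_frechetSubdiff_iff h.isOpen_left hf hx] at hp
  -- Steps tending to zero, scaled so that `x + t k • v` stays in the ball of radius `r`.
  set t : ℕ → ℝ := fun k => r / (‖v‖ + 1) * (1 / ((k : ℝ) + 1)) with ht
  have ht0 : ∀ k, 0 < t k := fun k => by positivity
  have hlim : Tendsto t atTop (𝓝 0) := by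
    simpa [ht] using tendsto_one_div_add_atTop_nhds_zero_nat.const_mul (r / (‖v‖ + 1))
  have hub : ∀ k, x + t k • v ∈ Metric.ball x r := by
    intro k
    rw [mem_ball_iff_norm, add_sub_cancel_left, norm_smul, Real.norm_of_nonneg (ht0 k).le]
    have h1 : t k ≤ r / (‖v‖ + 1) := mul_le_of_le_one_right (by positivity)
      (by rw [div_le_one (by positivity)]; linarith [(Nat.cast_nonneg k : (0 : ℝ) ≤ k)])
    calc t k * ‖v‖ ≤ r / (‖v‖ + 1) * ‖v‖ := by gcongr
      _ < r / (‖v‖ + 1) * (‖v‖ + 1) := by gcongr; linarith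
      _ = r := by field_simp
  have hux : Tendsto (fun k => x + t k • v) atTop (𝓝 x) := by
    simpa using (hlim.smul_const v).const_add x
  choose w hw using fun k => hne _ (hball (hub k))
  obtain ⟨y, hy, φ, hφ, hwy⟩ := h.isCompact_closure.tendsto_subseq (fun k => (hw k).1)
  have hyS : y ∈ realSubdiff c X Y f x :=
    h.mem_realSubdiff_of_tendsto hx (hne x hx) (fun k => hball (hub (φ k)))
      (fun k => hw (φ k)) (hux.comp hφ.tendsto_atTop) hwy
  refine ⟨y, hyS, ?_⟩
  have hε : ∀ ε : ℝ, 0 < ε → inner ℝ p v ≤ inner ℝ (-gradX c x y) v + ε * ‖v‖ := by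
    intro ε hε
    have h1 : Tendsto (fun k => inner ℝ (-gradX c x (w (φ k))) v + M * t (φ k) * ‖v‖ ^ 2
        + ε * ‖v‖) atTop (𝓝 (inner ℝ (-gradX c x y) v + M * 0 * ‖v‖ ^ 2 + ε * ‖v‖)) :=
      ((((h.tendsto_gradX hx hy (fun k => (hw _).1) hwy).neg.inner tendsto_const_nhds).add
        (((hlim.comp hφ.tendsto_atTop).const_mul M).mul_const _)).add_const _)
    rw [mul_zero, zero_mul, add_zero] at h1
    refine ge_of_tendsto h1 ?_
    filter_upwards [(hux.comp hφ.tendsto_atTop).eventually (hp ε hε)] with k hk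
    simp only [Function.comp_apply, add_sub_cancel_left, inner_smul_right, norm_smul,
      Real.norm_of_nonneg (ht0 (φ k)).le] at hk
    -- Testing at `x` the `c`-subgradient taken at `x + t v` bounds `f (x + t v) - f x` above; the
    -- Fréchet inequality `hk` bounds it below. Both are then divided by `t`.
    have h2 := (hw (φ k)).2 x hx
    rw [inner_neg_left]
    refine le_of_mul_le_mul_left ?_ (ht0 (φ k))
    have h4 := (abs_le.1 (hq x r hr hball _ (hw (φ k)).1 _ (hub (φ k)))).1
    simp only [add_sub_cancel_left, inner_smul_right, norm_smul,
      Real.norm_of_nonneg (ht0 (φ k)).le] at h4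
    nlinarith
  refine le_of_forall_pos_le_add fun δ hδ => ?_
  refine (hε (δ / (‖v‖ + 1)) (by positivity)).trans (add_le_add le_rfl ?_)
  rw [div_mul_eq_mul_div, div_le_iff₀ (by positivity)]
  nlinarith [norm_nonneg v]

end Admissible

/-- A point whose scalar products are dominated by those of points of a closed convex set lies
in that set. -/
theorem mem_of_forall_exists_inner_le {A : Set (𝔼 n)} (hA : Convex ℝ A) (hAc : IsClosed A)
    {p : 𝔼 n} (hp : ∀ v : 𝔼 n, ∃ a ∈ A, inner ℝ p v ≤ inner ℝ a v) : p ∈ A := by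
  by_contra hpA
  obtain ⟨g, u, hg, hu⟩ := geometric_hahn_banach_closed_point hA hAc hpA
  obtain ⟨a, ha, hle⟩ := hp ((InnerProductSpace.toDual ℝ (𝔼 n)).symm g)
  rw [real_inner_comm, InnerProductSpace.toDual_symm_apply, real_inner_comm,
    InnerProductSpace.toDual_symm_apply] at hle
  linarith [hg a ha]

/-! ### From the inequality along `c`-segments to connected and convex subdifferentials. -/

namespace Admissible

/-- The points `y₀, y₁` may lie on the boundary, so the inequality is applied to approximating
points of `Y`. In the limit, `c z y - c x y` is at least a minimum of two quantities, each at least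
`f x - f z`. -/
theorem mem_realSubdiff_of_tendsto_cSeg (h : Admissible c X Y) (hseg : CSegInequality c X Y)
    {f : (𝔼 n) → ℝ} {x y₀ y₁ y : 𝔼 n} (hx : x ∈ X) (h₀ : y₀ ∈ realSubdiff c X Y f x)
    (h₁ : y₁ ∈ realSubdiff c X Y f x) {a b : ℕ → 𝔼 n} {t : ℕ → ℝ} (ha : ∀ k, a k ∈ Y)
    (hb : ∀ k, b k ∈ Y) (ht : ∀ k, t k ∈ Icc (0 : ℝ) 1) (hay : Tendsto a atTop (𝓝 y₀))
    (hby : Tendsto b atTop (𝓝 y₁))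
    (hy : Tendsto (fun k => cSeg c Y x (a k) (b k) (t k)) atTop (𝓝 y)) :
    y ∈ realSubdiff c X Y f x := by
  have hmem : ∀ k, cSeg c Y x (a k) (b k) (t k) ∈ closure Y := fun k =>
    subset_closure (h.cSeg_mem hx (ha k) (hb k) (ht k))
  have hycl : y ∈ closure Y := isClosed_closure.mem_of_tendsto hy (Eventually.of_forall hmem)
  refine ⟨hycl, fun z hz => ?_⟩
  have hlim : ∀ {v : ℕ → 𝔼 n} {w : 𝔼 n}, w ∈ closure Y → (∀ k, v k ∈ closure Y) →
      Tendsto v atTop (𝓝 w) → Tendsto (fun k => c z (v k) - c x (v k)) atTop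
        (𝓝 (c z w - c x w)) := fun hw hv hvw =>
    (h.tendsto_cost hz hw (fun _ => hz) hv tendsto_const_nhds hvw).sub
      (h.tendsto_cost hx hw (fun _ => hx) hv tendsto_const_nhds hvw)
  have h1 := le_of_tendsto_of_tendsto'
    ((hlim h₀.1 (fun k => subset_closure (ha k)) hay).min
      (hlim h₁.1 (fun k => subset_closure (hb k)) hby)) (hlim hycl hmem hy)
    (fun k => hseg x hx _ (ha k) _ (hb k) (h.cSegIn hx (ha k) (hb k)) z hz _ (ht k))
  have h2 := h₀.2 z hz
  have h3 := h₁.2 z hz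
  rcases min_le_iff.1 h1 with h4 | h4 <;> linarith

/-- If the compact set split into two pieces, `c`-segments between approximants of a point in each
would leave disjoint neighbourhoods `U`, `V` of the pieces. A limit of exit points is a
`c`-subgradient in neither piece. -/
theorem isConnected_realSubdiff (h : Admissible c X Y) (hseg : CSegInequality c X Y)
    {f : (𝔼 n) → ℝ} {x : 𝔼 n} (hx : x ∈ X) (hne : (realSubdiff c X Y f x).Nonempty) :
    IsConnected (realSubdiff c X Y f x) := by
  refine ⟨hne, isPreconnected_closed_iff.2 fun A B hA hB hsub hneA hneB => ?_⟩
  by_contra hcon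
  have hK := h.isCompact_realSubdiff (f := f) hx
  have hdisj : Disjoint (realSubdiff c X Y f x ∩ A) (realSubdiff c X Y f x ∩ B) := by
    rw [Set.disjoint_left]
    exact fun y hyA hyB => hcon ⟨y, hyA.1, hyA.2, hyB.2⟩
  obtain ⟨U, V, hU, hV, hAU, hBV, hUV⟩ :=
    SeparatedNhds.of_isCompact_isCompact (hK.inter_right hA) (hK.inter_right hB) hdisj
  obtain ⟨y₀, hy₀⟩ := hneA
  obtain ⟨y₁, hy₁⟩ := hneB
  obtain ⟨a, ha, hay⟩ := mem_closure_iff_seq_limit.1 hy₀.1.1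
  obtain ⟨b, hb, hby⟩ := mem_closure_iff_seq_limit.1 hy₁.1.1
  obtain ⟨N, hN⟩ := eventually_atTop.1
    ((hay.eventually (hU.mem_nhds (hAU hy₀))).and (hby.eventually (hV.mem_nhds (hBV hy₁))))
  have key : ∀ k : ℕ, ∃ t ∈ Icc (0 : ℝ) 1,
      cSeg c Y x (a (k + N)) (b (k + N)) t ∉ U ∪ V := by
    intro k
    by_contra! hc
    have hpre : IsPreconnected (cSeg c Y x (a (k + N)) (b (k + N)) '' Icc 0 1) :=
      isPreconnected_Icc.image _ (h.continuousOn_cSeg hx (ha _) (hb _))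
    obtain ⟨q, -, hqU, hqV⟩ := hpre U V hU hV (by rintro _ ⟨t, ht, rfl⟩; exact hc t ht)
      ⟨a (k + N), ⟨0, by simp, h.cSeg_zero hx (ha _)⟩, (hN _ (Nat.le_add_left _ _)).1⟩
      ⟨b (k + N), ⟨1, by simp, h.cSeg_one hx (hb _)⟩, (hN _ (Nat.le_add_left _ _)).2⟩
    exact Set.disjoint_left.1 hUV hqU hqV
  choose t ht htUV using key
  obtain ⟨y, hy, φ, hφ, hlim⟩ := h.isCompact_closure.tendsto_subseq
    (fun k => subset_closure (h.cSeg_mem hx (ha (k + N)) (hb (k + N)) (ht k)))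
  have hsh : Tendsto (fun k => φ k + N) atTop atTop :=
    (tendsto_add_atTop_nat N).comp hφ.tendsto_atTop
  have hyS : y ∈ realSubdiff c X Y f x :=
    h.mem_realSubdiff_of_tendsto_cSeg hseg hx hy₀.1 hy₁.1 (fun k => ha (φ k + N))
      (fun k => hb (φ k + N)) (fun k => ht (φ k)) (hay.comp hsh) (hby.comp hsh) hlim
  have hyUV : y ∈ (U ∪ V)ᶜ := (hU.union hV).isClosed_compl.mem_of_tendsto hlim
    (Eventually.of_forall fun k => htUV (φ k))
  rcases hsub hyS with hyA | hyB
  · exact hyUV (Or.inl (hAU ⟨hyS, hyA⟩))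
  · exact hyUV (Or.inr (hBV ⟨hyS, hyB⟩))

theorem convex_image_realSubdiff (h : Admissible c X Y) (hseg : CSegInequality c X Y)
    {f : (𝔼 n) → ℝ} {x : 𝔼 n} (hx : x ∈ X) :
    Convex ℝ ((fun y => -gradX c x y) '' realSubdiff c X Y f x) := by
  rintro _ ⟨y₀, hy₀, rfl⟩ _ ⟨y₁, hy₁, rfl⟩ s t hs ht hst
  obtain rfl : s = 1 - t := by linarith
  have htI : t ∈ Icc (0 : ℝ) 1 := ⟨ht, by linarith⟩
  obtain ⟨a, ha, hay⟩ := mem_closure_iff_seq_limit.1 hy₀.1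
  obtain ⟨b, hb, hby⟩ := mem_closure_iff_seq_limit.1 hy₁.1
  have hcl : ∀ k, cSeg c Y x (a k) (b k) t ∈ closure Y := fun k =>
    subset_closure (h.cSeg_mem hx (ha k) (hb k) htI)
  obtain ⟨y, hy, φ, hφ, hlim⟩ := h.isCompact_closure.tendsto_subseq hcl
  refine ⟨y, h.mem_realSubdiff_of_tendsto_cSeg hseg hx hy₀ hy₁ (fun k => ha (φ k))
      (fun k => hb (φ k)) (fun k => htI) (hay.comp hφ.tendsto_atTop)
      (hby.comp hφ.tendsto_atTop) hlim, ?_⟩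
  have h1 := (h.tendsto_gradX hx hy (fun k => hcl (φ k)) hlim).neg
  simp only [h.neg_gradX_cSeg hx (ha _) (hb _) htI] at h1
  refine tendsto_nhds_unique h1 (Tendsto.add ?_ ?_)
  · exact (h.tendsto_gradX hx hy₀.1 (fun k => subset_closure (ha (φ k)))
      (hay.comp hφ.tendsto_atTop)).neg.const_smul (1 - t)
  · exact (h.tendsto_gradX hx hy₁.1 (fun k => subset_closure (hb (φ k)))
      (hby.comp hφ.tendsto_atTop)).neg.const_smul t

theorem connectedSubdiffs_of_cSegInequality (h : Admissible c X Y)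
    (hseg : CSegInequality c X Y) : ConnectedSubdiffs c X Y := by
  intro ψ hψ x hx
  obtain ⟨f, hf⟩ := h.exists_real hψ
  rw [cSubdiff_eq_realSubdiff hf hx]
  exact h.isConnected_realSubdiff hseg hx (h.nonempty_realSubdiff hψ hf hx)

theorem convexSubdiffs_of_cSegInequality (h : Admissible c X Y)
    (hseg : CSegInequality c X Y) : ConvexSubdiffs c X Y := by
  intro ψ hψ x hx
  obtain ⟨f, hf⟩ := h.exists_real hψ
  rw [cSubdiff_eq_realSubdiff hf hx]
  have hconv := h.convex_image_realSubdiff hseg (f := f) hx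
  refine ⟨hconv, (h.image_subset_frechetSubdiff hf hx).antisymm fun p hp => ?_⟩
  -- The image is convex and compact, so domination in every direction places `p` in it.
  refine mem_of_forall_exists_inner_le hconv (h.isCompact_image_realSubdiff hx).isClosed
    fun v => ?_
  obtain ⟨y, hy, hle⟩ := h.exists_inner_le hf (fun x hx => h.nonempty_realSubdiff hψ hf hx) hx hp v
  exact ⟨_, mem_image_of_mem _ hy, hle⟩

end Admissible

/-! ### The converse: maxima of two `c`-affine functions. -/

/-- The maximum of the two functions `-c(·, y₀) + c(x, y₀)` and `-c(·, y₁) + c(x, y₁)`. -/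
def maxTwo (c : (𝔼 n) → (𝔼 n) → ℝ) (x y₀ y₁ : 𝔼 n) (z : 𝔼 n) : ℝ :=
  max (c x y₀ - c z y₀) (c x y₁ - c z y₁)

theorem maxTwo_self (x y₀ y₁ : 𝔼 n) : maxTwo c x y₀ y₁ x = 0 := by simp [maxTwo]

theorem isCConvex_maxTwo {x y₀ y₁ : 𝔼 n} (hx : x ∈ X) (h₀ : y₀ ∈ Y) (h₁ : y₁ ∈ Y) :
    IsCConvex c X Y (fun z => (maxTwo c x y₀ y₁ z : EReal)) := by
  refine isCConvex_coe ⟨x, hx⟩ fun z hz => ?_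
  rcases max_choice (c x y₀ - c z y₀) (c x y₁ - c z y₁) with hm | hm
  · exact ⟨y₀, h₀, fun w hw => by
      have := le_max_left (c x y₀ - c w y₀) (c x y₁ - c w y₁)
      unfold maxTwo; linarith⟩
  · exact ⟨y₁, h₁, fun w hw => by
      have := le_max_right (c x y₀ - c w y₀) (c x y₁ - c w y₁)
      unfold maxTwo; linarith⟩

theorem left_mem_realSubdiff_maxTwo {x y₀ y₁ : 𝔼 n} (h₀ : y₀ ∈ Y) :
    y₀ ∈ realSubdiff c X Y (maxTwo c x y₀ y₁) x :=
  ⟨subset_closure h₀, fun z _ => by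
    rw [maxTwo_self, zero_add]; exact le_max_left _ _⟩

theorem right_mem_realSubdiff_maxTwo {x y₀ y₁ : 𝔼 n} (h₁ : y₁ ∈ Y) :
    y₁ ∈ realSubdiff c X Y (maxTwo c x y₀ y₁) x :=
  ⟨subset_closure h₁, fun z _ => by
    rw [maxTwo_self, zero_add]; exact le_max_right _ _⟩

theorem min_le_of_le_maxTwo {x y₀ y₁ y z : 𝔼 n} (hz : c x y - c z y ≤ maxTwo c x y₀ y₁ z) :
    min (c z y₀ - c x y₀) (c z y₁ - c x y₁) ≤ c z y - c x y := by
  rcases le_max_iff.1 hz with h1 | h1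
  · exact (min_le_left _ _).trans (by linarith)
  · exact (min_le_right _ _).trans (by linarith)

namespace Admissible

/-- The given `c`-subgradient might lie on the boundary of `Y`, but it has the same gradient as the
interior point `y_t` and so coincides with it. Support of the maximum by `y_t` is the desired
inequality. -/
theorem cSegInequality_of_exists (h : Admissible c X Y)
    (hex : ∀ x ∈ X, ∀ y₀ ∈ Y, ∀ y₁ ∈ Y, ∀ t ∈ Icc (0 : ℝ) 1,
      pSeg c x y₀ y₁ t ∈ (fun y => -gradX c x y) '' realSubdiff c X Y (maxTwo c x y₀ y₁) x) :
    CSegInequality c X Y := by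
  intro x hx y₀ h₀ y₁ h₁ _ z hz t ht
  obtain ⟨y, hy, hyp⟩ := hex x hx y₀ h₀ y₁ h₁ t ht
  have heq : y = cSeg c Y x y₀ y₁ t := by
    refine h.eq_of_gradX_eq hx hy.1 (h.cSeg_mem hx h₀ h₁ ht) (neg_injective ?_)
    rw [h.neg_gradX_cSeg hx h₀ h₁ ht, ← hyp]
  rw [← heq]
  have := hy.2 z hz
  rw [maxTwo_self, zero_add] at this
  exact min_le_of_le_maxTwo this

theorem cSegInequality_of_convexSubdiffs (h : Admissible c X Y) (hconv : ConvexSubdiffs c X Y) :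
    CSegInequality c X Y := by
  refine h.cSegInequality_of_exists fun x hx y₀ h₀ y₁ h₁ t ht => ?_
  have h1 := (hconv _ (isCConvex_maxTwo hx h₀ h₁) x hx).1
  rw [cSubdiff_eq_realSubdiff (fun _ _ => rfl) hx] at h1
  exact h1 (mem_image_of_mem _ (left_mem_realSubdiff_maxTwo h₀))
    (mem_image_of_mem _ (right_mem_realSubdiff_maxTwo h₁)) (by linarith [ht.2]) ht.1 (by ring)

/-- To first order at `x` the maximum is the larger of two linear forms, that is, the support
function of the segment. A supporting slope is dominated by it in every direction, hence lies in the
segment. -/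
theorem image_realSubdiff_maxTwo_subset (h : Admissible c X Y) {x y₀ y₁ : 𝔼 n} (hx : x ∈ X)
    (h₀ : y₀ ∈ Y) (h₁ : y₁ ∈ Y) :
    (fun y => -gradX c x y) '' realSubdiff c X Y (maxTwo c x y₀ y₁) x ⊆
      segment ℝ (-gradX c x y₀) (-gradX c x y₁) := by
  obtain ⟨M, hM0, -, -, hq, -⟩ := h.exists_bound
  obtain ⟨r, hr, hball⟩ := Metric.isOpen_iff.1 h.isOpen_left x hx
  rintro _ ⟨y, hy, rfl⟩
  have hcpt : IsCompact (segment ℝ (-gradX c x y₀) (-gradX c x y₁)) := by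
    rw [segment_eq_image]
    exact isCompact_Icc.image (by fun_prop)
  refine mem_of_forall_exists_inner_le (convex_segment _ _) hcpt.isClosed fun v => ?_
  have hmax : inner ℝ (-gradX c x y) v ≤
      max (inner ℝ (-gradX c x y₀) v) (inner ℝ (-gradX c x y₁) v) := by
    have hlim : Tendsto (fun s : ℝ => max (inner ℝ (-gradX c x y₀) v)
        (inner ℝ (-gradX c x y₁) v) + 2 * M * s * ‖v‖ ^ 2) (𝓝[>] 0)
        (𝓝 (max (inner ℝ (-gradX c x y₀) v) (inner ℝ (-gradX c x y₁) v) +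
          2 * M * 0 * ‖v‖ ^ 2)) :=
      (Continuous.tendsto (by fun_prop) 0).mono_left nhdsWithin_le_nhds
    rw [mul_zero, zero_mul, add_zero] at hlim
    have hcont : Tendsto (fun s : ℝ => x + s • v) (𝓝[>] 0) (𝓝 x) := by
      have : Tendsto (fun s : ℝ => x + s • v) (𝓝 0) (𝓝 (x + (0 : ℝ) • v)) :=
        Continuous.tendsto (by fun_prop) 0
      rw [zero_smul, add_zero] at this
      exact this.mono_left nhdsWithin_le_nhds
    refine ge_of_tendsto hlim ?_
    filter_upwards [self_mem_nhdsWithin, hcont.eventually (Metric.ball_mem_nhds x hr)]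
      with s hs hsb
    replace hs : 0 < s := hs
    have hbd : ∀ y ∈ closure Y, |c (x + s • v) y - c x y - s * inner ℝ (gradX c x y) v| ≤
        M * (s * ‖v‖) ^ 2 := fun y hy => by
      simpa [inner_smul_right, norm_smul, abs_of_pos hs] using hq x r hr hball y hy _ hsb
    have h2 := hy.2 _ (hball hsb)
    rw [maxTwo_self, zero_add] at h2
    have hy' := (abs_le.1 (hbd y hy.1)).2
    refine le_of_mul_le_mul_left ?_ hs
    rcases le_max_iff.1 h2 with h3 | h3
    · have h4 := (abs_le.1 (hbd y₀ (subset_closure h₀))).1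
      have h5 := mul_le_mul_of_nonneg_left
        (le_max_left (inner ℝ (-gradX c x y₀) v) (inner ℝ (-gradX c x y₁) v)) hs.le
      rw [mul_add]
      simp only [inner_neg_left] at h5 ⊢
      linarith
    · have h4 := (abs_le.1 (hbd y₁ (subset_closure h₁))).1
      have h5 := mul_le_mul_of_nonneg_left
        (le_max_right (inner ℝ (-gradX c x y₀) v) (inner ℝ (-gradX c x y₁) v)) hs.le
      rw [mul_add]
      simp only [inner_neg_left] at h5 ⊢
      linarith
  rcases le_max_iff.1 hmax with h1 | h1
  · exact ⟨_, left_mem_segment _ _ _, h1⟩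
  · exact ⟨_, right_mem_segment _ _ _, h1⟩

end Admissible

/-- Projecting to the direction `q - p` turns `A` into an interval containing the projections of
both end points, and a point of the segment is determined by its projection. -/
theorem segment_subset_of_isPreconnected {A : Set (𝔼 n)} {p q : 𝔼 n} (hA : IsPreconnected A)
    (hp : p ∈ A) (hq : q ∈ A) (hsub : A ⊆ segment ℝ p q) : segment ℝ p q ⊆ A := by
  intro w hw
  rw [segment_eq_image_lineMap] at hw hsub
  obtain ⟨t, ht, rfl⟩ := hw
  have h1 : IsPreconnected ((fun a => inner ℝ (q - p) (a - p)) '' A) :=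
    hA.image _ (by fun_prop)
  have h2 := h1.ordConnected.out ⟨p, hp, rfl⟩ ⟨q, hq, rfl⟩
  have h3 : t * ‖q - p‖ ^ 2 ∈ Icc (inner ℝ (q - p) (p - p)) (inner ℝ (q - p) (q - p)) := by
    rw [sub_self, inner_zero_right, real_inner_self_eq_norm_sq]
    exact ⟨by have := ht.1; positivity, mul_le_of_le_one_left (by positivity) ht.2⟩
  obtain ⟨a, ha, hat⟩ := h2 h3
  obtain ⟨s, hs, rfl⟩ := hsub ha
  simp only [AffineMap.lineMap_apply, vsub_eq_sub, vadd_eq_add, add_sub_cancel_right,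
    inner_smul_right, real_inner_self_eq_norm_sq] at hat
  rcases eq_or_ne (q - p) 0 with h0 | h0
  · rw [sub_eq_zero] at h0
    subst h0
    simpa using ha
  · have : s = t := mul_right_cancel₀ (by positivity) hat
    rwa [← this]

namespace Admissible

theorem cSegInequality_of_connectedSubdiffs (h : Admissible c X Y)
    (hconn : ConnectedSubdiffs c X Y) : CSegInequality c X Y := by
  refine h.cSegInequality_of_exists fun x hx y₀ h₀ y₁ h₁ t ht => ?_
  have h1 := hconn _ (isCConvex_maxTwo hx h₀ h₁) x hx
  rw [cSubdiff_eq_realSubdiff (fun _ _ => rfl) hx] at h1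
  refine segment_subset_of_isPreconnected (h1.isPreconnected.image _
    ((h.continuousOn_gradX hx).neg.mono fun _ hy => hy.1))
    (mem_image_of_mem _ (left_mem_realSubdiff_maxTwo h₀))
    (mem_image_of_mem _ (right_mem_realSubdiff_maxTwo h₁))
    (h.image_realSubdiff_maxTwo_subset hx h₀ h₁) ?_
  exact ⟨1 - t, t, by linarith [ht.2], ht.1, by ring, rfl⟩

theorem tfae_cSegInequality (h : Admissible c X Y) :
    List.TFAE [ConnectedSubdiffs c X Y, ConvexSubdiffs c X Y, CSegInequality c X Y] := by
  tfae_have 1 → 3 := h.cSegInequality_of_connectedSubdiffs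
  tfae_have 2 → 3 := h.cSegInequality_of_convexSubdiffs
  tfae_have 3 → 1 := h.connectedSubdiffs_of_cSegInequality
  tfae_have 3 → 2 := h.convexSubdiffs_of_cSegInequality
  tfae_finish

/-! ### Density of C¹ functions forces the inequality along `c`-segments. -/

theorem cSegInequality_of_c1Dense (h : Admissible c X Y)
    (hlip : ∃ L, ∀ y ∈ Y, LipschitzOnWith L (fun x => c x y) X) (hd : C1Dense c X Y) :
    CSegInequality c X Y := by
  intro xb hxb y₀ h₀ y₁ h₁ _ z hz t ht
  obtain ⟨L, hL⟩ := hlip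
  obtain ⟨M, hM0, -, -, hq, -⟩ := h.exists_bound
  obtain ⟨M', hgl⟩ := h.norm_gradX_sub_le
  obtain ⟨r, hr, hball⟩ := Metric.isOpen_iff.1 h.isOpen_left xb hxb
  set f := maxTwo c xb y₀ y₁ with hf
  set p := pSeg c xb y₀ y₁ t with hp
  have hflip : ∃ L, LipschitzOnWith L f X := by
    refine ⟨L, LipschitzOnWith.of_dist_le_mul fun a ha b hb => ?_⟩
    rw [Real.dist_eq]
    refine (abs_max_sub_max_le_max _ _ _ _).trans (max_le ?_ ?_)
    · rw [sub_sub_sub_cancel_left, ← Real.dist_eq, dist_comm]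
      exact (hL y₀ h₀).dist_le_mul a ha b hb
    · rw [sub_sub_sub_cancel_left, ← Real.dist_eq, dist_comm]
      exact (hL y₁ h₁).dist_le_mul a ha b hb
  set B := Metric.closedBall xb (r / 2) with hB
  have hBball : B ⊆ Metric.ball xb r := Metric.closedBall_subset_ball (by linarith)
  -- Approximation is needed on a ball, for the minimisation, and at `z`, where the inequality is
  -- tested.
  have hKc : IsCompact (B ∪ {z}) := (isCompact_closedBall _ _).union isCompact_singleton
  have hKX : B ∪ {z} ⊆ X := union_subset (hBball.trans hball) (singleton_subset_iff.2 hz)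
  -- `f` dominates the convex combination, with weights `1 - t` and `t`, of its two branches, whose
  -- slope at `xb` is `p`.
  have hfB : ∀ x ∈ B, inner ℝ p (x - xb) - M * ‖x - xb‖ ^ 2 ≤ f x := by
    intro x hx
    have e0 := (abs_le.1 (hq xb r hr hball y₀ (subset_closure h₀) x (hBball hx))).2
    have e1 := (abs_le.1 (hq xb r hr hball y₁ (subset_closure h₁) x (hBball hx))).2
    have m0 : c xb y₀ - c x y₀ ≤ f x := le_max_left _ _
    have m1 : c xb y₁ - c x y₁ ≤ f x := le_max_right _ _
    simp only [hp, pSeg, inner_add_left, inner_smul_left, inner_neg_left, conj_trivial]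
    nlinarith [ht.1, ht.2, mul_le_mul_of_nonneg_left (show -inner ℝ (gradX c xb y₀) (x - xb)
      - M * ‖x - xb‖ ^ 2 ≤ f x by linarith) (sub_nonneg.2 ht.2),
      mul_le_mul_of_nonneg_left (show -inner ℝ (gradX c xb y₁) (x - xb)
      - M * ‖x - xb‖ ^ 2 ≤ f x by linarith) ht.1]
  have key : ∀ k : ℕ, ∃ x ∈ B, ∃ y ∈ closure Y,
      (M + 1) * ‖x - xb‖ ^ 2 ≤ 2 * (1 / ((k : ℝ) + 1)) ∧
      (‖x - xb‖ < r / 2 → -gradX c x y = p - (4 * (M + 1)) • (x - xb)) ∧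
      inner ℝ p (x - xb) - M * ‖x - xb‖ ^ 2 - 1 / ((k : ℝ) + 1) + c x y - c z y ≤
        f z + 1 / ((k : ℝ) + 1) := by
    intro k
    obtain ⟨φ, hφ, hφ1, hφK⟩ := hd f (isCConvex_maxTwo hxb h₀ h₁) hflip (B ∪ {z}) hKX hKc
      (1 / ((k : ℝ) + 1)) (by positivity)
    -- The penalty coefficient `2 * (M + 1)` exceeds the possible concavity `M` in `hfB`, so
    -- minimisers are forced towards `xb` as the approximation improves.
    set m : (𝔼 n) → ℝ := fun x => φ x - inner ℝ p (x - xb) + 2 * (M + 1) * ‖x - xb‖ ^ 2 with hm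
    have hmc : ContinuousOn m B :=
      ((hφ1.continuousOn.mono (hBball.trans hball)).sub (by fun_prop)).add (by fun_prop)
    obtain ⟨x, hxB, hmin⟩ := (isCompact_closedBall xb (r / 2)).exists_isMinOn
      ⟨xb, Metric.mem_closedBall_self (by linarith)⟩ hmc
    have hxX : x ∈ X := hball (hBball hxB)
    obtain ⟨y, hy, hyz⟩ := h.nonempty_realSubdiff hφ (fun _ _ => rfl) hxX
    have hφx := abs_lt.1 (hφK x (Or.inl hxB))
    have hφz := abs_lt.1 (hφK z (Or.inr rfl))
    have hφb := abs_lt.1 (hφK xb (Or.inl (Metric.mem_closedBall_self (by linarith))))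
    have hfb : f xb = 0 := maxTwo_self _ _ _
    refine ⟨x, hxB, y, hy, ?_, fun hlt => ?_, ?_⟩
    · have h1 : m x ≤ m xb := hmin (Metric.mem_closedBall_self (by linarith))
      simp only [hm, sub_self, inner_zero_right, norm_zero] at h1
      have h2 := hfB x hxB
      nlinarith [sq_nonneg ‖x - xb‖]
    · have hφd : DifferentiableAt ℝ φ x :=
        (hφ1.contDiffAt (h.isOpen_left.mem_nhds hxX)).differentiableAt (by norm_num)
      have hmd : HasFDerivAt m (fderiv ℝ φ x - InnerProductSpace.toDual ℝ (𝔼 n) p +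
          (2 * (M + 1)) • ((2 : ℝ) • InnerProductSpace.toDual ℝ (𝔼 n) (x - xb))) x := by
        have e1 : HasFDerivAt (fun x => inner ℝ p (x - xb))
            (InnerProductSpace.toDual ℝ (𝔼 n) p) x := by
          exact ((InnerProductSpace.toDual ℝ (𝔼 n) p).hasFDerivAt (x := x - xb)).comp x
            ((hasFDerivAt_id x).sub_const xb)
        have e2 : HasFDerivAt (fun x => ‖x - xb‖ ^ 2)
            ((2 : ℝ) • InnerProductSpace.toDual ℝ (𝔼 n) (x - xb)) x := by
          have := ((hasFDerivAt_id x).sub_const xb).norm_sq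
          refine this.congr_fderiv ?_
          ext w
          simp [two_smul]
        exact (hφd.hasFDerivAt.sub e1).add (e2.const_mul _)
      have hloc : IsLocalMin m x := hmin.isLocalMin
        (Filter.mem_of_superset (Metric.isOpen_ball.mem_nhds (mem_ball_iff_norm.2 hlt))
          Metric.ball_subset_closedBall)
      have hm0 := hloc.hasFDerivAt_eq_zero hmd
      -- A `c`-subgradient `y` at `x` makes `φ + c(·, y)` minimal there; as `φ` is differentiable,
      -- `-D_x c(x, y)` equals `∇φ(x)`, which `hm0` computes.
      have hloc2 : IsLocalMin (fun w => φ w + c w y) x := by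
        filter_upwards [h.isOpen_left.mem_nhds hxX] with w hw
        have := hyz w hw
        linarith
      have hcd := (hq x (r - ‖x - xb‖) (by linarith) ((Metric.ball_subset_ball' (by
        rw [dist_eq_norm]; linarith)).trans hball) y hy).hasGradientAt (by linarith)
      rw [hasGradientAt_iff_hasFDerivAt] at hcd
      have hc0 := hloc2.hasFDerivAt_eq_zero (hφd.hasFDerivAt.add hcd)
      refine (InnerProductSpace.toDual ℝ (𝔼 n)).injective ?_
      ext w
      have a1 := DFunLike.congr_fun hm0 w
      have a2 := DFunLike.congr_fun hc0 w
      simp only [_root_.add_apply, _root_.sub_apply,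
        _root_.smul_apply, InnerProductSpace.toDual_apply_apply, smul_eq_mul,
        _root_.zero_apply, inner_neg_left, inner_sub_left (p) _ w,
        inner_smul_left, conj_trivial] at a1 a2 ⊢
      linarith
    · have h2 := hfB x hxB
      have h3 := hyz z hz
      linarith
  choose u hu v hv h1 h2 h3 using key
  have h10 := tendsto_one_div_add_atTop_nhds_zero_nat (𝕜 := ℝ)
  have hux : Tendsto u atTop (𝓝 xb) := by
    rw [tendsto_iff_norm_sub_tendsto_zero]
    have hsq : Tendsto (fun k => ‖u k - xb‖ ^ 2) atTop (𝓝 0) := by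
      refine squeeze_zero (g := fun k : ℕ => 2 * (1 / ((k : ℝ) + 1))) (fun _ => by positivity)
        (fun k => ?_) (by simpa only [mul_zero] using h10.const_mul 2)
      nlinarith [h1 k, mul_nonneg hM0 (sq_nonneg ‖u k - xb‖)]
    simpa using hsq.sqrt
  obtain ⟨y, hy, σ, hσ, hlim⟩ := h.isCompact_closure.tendsto_subseq hv
  have huσ := hux.comp hσ.tendsto_atTop
  have huX : ∀ k, u k ∈ X := fun k => hball (hBball (hu k))
  have hnorm : Tendsto (fun k => ‖u (σ k) - xb‖) atTop (𝓝 0) :=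
    tendsto_iff_norm_sub_tendsto_zero.1 huσ
  have hgrad : -gradX c xb y = p := by
    have e1 := (h.tendsto_gradX hxb hy (fun k => hv (σ k)) hlim).neg
    -- The Lipschitz bound in `x`, uniform in `y`, allows the moving base point to be replaced by
    -- `xb`.
    have e2 : Tendsto (fun k => gradX c (u (σ k)) (v (σ k)) - gradX c xb (v (σ k))) atTop
        (𝓝 0) := by
      refine squeeze_zero_norm (fun k => hgl xb r hr hball _ (hv _) _ (hBball (hu _))) ?_
      simpa using hnorm.const_mul M'
    have e3 : Tendsto (fun k => p - (4 * (M + 1)) • (u (σ k) - xb)) atTop (𝓝 p) := by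
      have := ((huσ.sub_const xb).const_smul (4 * (M + 1))).const_sub p
      simpa using this
    have e4 := e1.sub e2
    rw [sub_zero] at e4
    refine tendsto_nhds_unique (e4.congr' ?_) e3
    -- The formula for the gradient holds once the minimiser is interior to the ball, hence for
    -- large `k`.
    filter_upwards [hnorm.eventually (gt_mem_nhds (show 0 < r / 2 by linarith))] with k hk
    rw [← h2 (σ k) hk]
    abel
  have heq : y = cSeg c Y xb y₀ y₁ t := by
    refine h.eq_of_gradX_eq hxb hy (h.cSeg_mem hxb h₀ h₁ ht) (neg_injective ?_)
    rw [h.neg_gradX_cSeg hxb h₀ h₁ ht, hgrad]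
  rw [← heq]
  refine min_le_of_le_maxTwo ?_
  have l1 := h.tendsto_cost hxb hy (fun k => huX (σ k)) (fun k => hv (σ k)) huσ hlim
  have l2 := h.tendsto_cost hz hy (fun _ => hz) (fun k => hv (σ k)) tendsto_const_nhds hlim
  have l3 := h10.comp hσ.tendsto_atTop
  have l4 : Tendsto (fun k => inner ℝ p (u (σ k) - xb) - M * ‖u (σ k) - xb‖ ^ 2) atTop
      (𝓝 (inner ℝ p (xb - xb) - M * 0 ^ 2)) :=
    (tendsto_const_nhds.inner (huσ.sub_const xb)).sub ((hnorm.pow 2).const_mul M)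
  have l5 := le_of_tendsto_of_tendsto' (((l4.sub l3).add l1).sub l2)
    ((tendsto_const_nhds (x := f z)).add l3) (fun k => h3 (σ k))
  simpa using l5

end Admissible

/-! ### Directional derivatives and second-order expansions. -/

/-- The derivative of `g` in the direction `u`. -/
noncomputable def dirDeriv {V : Type*} [NormedAddCommGroup V] [NormedSpace ℝ V] (u : V) (g : V → ℝ) (z : V) : ℝ :=
  fderiv ℝ g z u

section Calculus

variable {V : Type*} [NormedAddCommGroup V] [NormedSpace ℝ V] {g g₁ g₂ : V → ℝ} {z u v w : V}

theorem contDiffAt_dirDeriv {k : WithTop ℕ∞} (hg : ContDiffAt ℝ (k + 1) g z) :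
    ContDiffAt ℝ k (dirDeriv u g) z :=
  (hg.fderiv_right le_rfl).clm_apply contDiffAt_const

theorem dirDeriv_congr (hg : g₁ =ᶠ[𝓝 z] g₂) : dirDeriv u g₁ =ᶠ[𝓝 z] dirDeriv u g₂ := by
  filter_upwards [hg.eventuallyEq_nhds] with y hy
  rw [dirDeriv, dirDeriv, hy.fderiv_eq]

theorem fderiv_fderiv_apply (hg : ContDiffAt ℝ 2 g z) :
    fderiv ℝ (fderiv ℝ g) z u v = dirDeriv u (dirDeriv v g) z := by
  have hd : DifferentiableAt ℝ (fderiv ℝ g) z :=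
    (hg.fderiv_right (m := 1) (by norm_num)).differentiableAt (by norm_num)
  have := hd.hasFDerivAt.clm_apply (hasFDerivAt_const v z)
  change _ = fderiv ℝ (fun y => fderiv ℝ g y v) z u
  rw [this.fderiv]
  simp

theorem dirDeriv_comm (hg : ContDiffAt ℝ 2 g z) :
    dirDeriv u (dirDeriv v g) z = dirDeriv v (dirDeriv u g) z := by
  rw [← fderiv_fderiv_apply hg, ← fderiv_fderiv_apply hg]
  exact (hg.isSymmSndFDerivAt (by simp)).eq u v

theorem dirDeriv_comm_eventually (hg : ContDiffAt ℝ 2 g z) :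
    dirDeriv u (dirDeriv v g) =ᶠ[𝓝 z] dirDeriv v (dirDeriv u g) := by
  filter_upwards [hg.eventually (by norm_num)] with y hy
  exact dirDeriv_comm hy

theorem dirDeriv_comm₃ (hg : ContDiffAt ℝ 3 g z) :
    dirDeriv u (dirDeriv v (dirDeriv v g)) z = dirDeriv v (dirDeriv v (dirDeriv u g)) z := by
  rw [dirDeriv_comm (contDiffAt_dirDeriv (by exact hg.of_le (by norm_num)))]
  exact (dirDeriv_congr (dirDeriv_comm_eventually (hg.of_le (by norm_num)))).eq_of_nhds

theorem dirDeriv_comm₄ (hg : ContDiffAt ℝ 4 g z) :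
    dirDeriv u (dirDeriv u (dirDeriv v (dirDeriv v g))) z =
      dirDeriv v (dirDeriv v (dirDeriv u (dirDeriv u g))) z := by
  have h3 : ∀ᶠ y in 𝓝 z, dirDeriv u (dirDeriv v (dirDeriv v g)) y =
      dirDeriv v (dirDeriv v (dirDeriv u g)) y := by
    filter_upwards [hg.eventually (by norm_num)] with y hy
    exact dirDeriv_comm₃ (hy.of_le (by norm_num))
  rw [(dirDeriv_congr h3).eq_of_nhds]
  exact dirDeriv_comm₃ (contDiffAt_dirDeriv (by norm_num; exact hg))

theorem contDiffAt_deriv {F : Type*} [NormedAddCommGroup F] [NormedSpace ℝ F] {f : ℝ → F} {s : ℝ}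
    {k : WithTop ℕ∞} (hf : ContDiffAt ℝ (k + 1) f s) : ContDiffAt ℝ k (deriv f) s :=
  (hf.fderiv_right le_rfl).clm_apply contDiffAt_const

variable {γ : ℝ → V} {s : ℝ}

theorem hasDerivAt_comp_curve (hg : DifferentiableAt ℝ g (γ s)) (hγ : DifferentiableAt ℝ γ s) :
    HasDerivAt (fun s => g (γ s)) (dirDeriv (deriv γ s) g (γ s)) s :=
  hg.hasFDerivAt.comp_hasDerivAt s hγ.hasDerivAt

theorem hasDerivAt_dirDeriv_comp_curve (hg : ContDiffAt ℝ 2 g (γ s)) (hγ : ContDiffAt ℝ 2 γ s) :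
    HasDerivAt (fun s => dirDeriv (deriv γ s) g (γ s))
      (dirDeriv (deriv γ s) (dirDeriv (deriv γ s) g) (γ s) +
        dirDeriv (deriv (deriv γ) s) g (γ s)) s := by
  have hd : DifferentiableAt ℝ (fderiv ℝ g) (γ s) :=
    (hg.fderiv_right (m := 1) (by norm_num)).differentiableAt (by norm_num)
  have hγ1 : DifferentiableAt ℝ γ s := hγ.differentiableAt (by norm_num)
  have hγ2 : DifferentiableAt ℝ (deriv γ) s :=
    (contDiffAt_deriv (k := 1) (by norm_num; exact hγ)).differentiableAt (by norm_num)
  rw [← fderiv_fderiv_apply hg]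
  exact (hd.hasFDerivAt.comp_hasDerivAt s hγ1.hasDerivAt).clm_apply hγ2.hasDerivAt

theorem deriv_comp_curve_eventually (hg : ContDiffAt ℝ 2 g (γ s)) (hγ : ContDiffAt ℝ 2 γ s) :
    deriv (fun s => g (γ s)) =ᶠ[𝓝 s] fun s => dirDeriv (deriv γ s) g (γ s) := by
  filter_upwards [hγ.continuousAt.eventually (hg.eventually (by norm_num)),
    hγ.eventually (by norm_num)] with r h1 h2
  exact (hasDerivAt_comp_curve (h1.differentiableAt (by norm_num))
    (h2.differentiableAt (by norm_num))).deriv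

theorem deriv_deriv_comp_curve (hg : ContDiffAt ℝ 2 g (γ s)) (hγ : ContDiffAt ℝ 2 γ s) :
    deriv (deriv (fun s => g (γ s))) s =
      dirDeriv (deriv γ s) (dirDeriv (deriv γ s) g) (γ s) +
        dirDeriv (deriv (deriv γ) s) g (γ s) := by
  rw [(deriv_comp_curve_eventually hg hγ).deriv_eq]
  exact (hasDerivAt_dirDeriv_comp_curve hg hγ).deriv

theorem iteratedDeriv_two {F : Type*} [NormedAddCommGroup F] [NormedSpace ℝ F] (f : ℝ → F) :
    iteratedDeriv 2 f = deriv (deriv f) := by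
  rw [iteratedDeriv_succ, iteratedDeriv_one]

theorem tendsto_taylor_two {k : ℝ → ℝ} (hk : ContDiffAt ℝ 2 k 0) :
    Tendsto (fun t => (k t - k 0 - deriv k 0 * t) / t ^ 2) (𝓝[≠] 0)
      (𝓝 (deriv (deriv k) 0 / 2)) := by
  have hd : DifferentiableAt ℝ (deriv k) 0 :=
    (contDiffAt_deriv (k := 1) (by norm_num; exact hk)).differentiableAt (by norm_num)
  have hs := (hasDerivAt_iff_tendsto_slope.1 hd.hasDerivAt).div_const 2
  refine HasDerivAt.lhopital_zero_nhdsNE (f := fun t => k t - k 0 - deriv k 0 * t)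
    (g := fun t => t ^ 2) (f' := fun t => deriv k t - deriv k 0) (g' := fun t => 2 * t)
    ?_ ?_ ?_ ?_ ?_ ?_
  · refine eventually_nhdsWithin_of_eventually_nhds ?_
    filter_upwards [hk.eventually (by norm_num)] with t ht
    have := ((ht.differentiableAt (by norm_num)).hasDerivAt.sub_const (k 0)).sub
      ((hasDerivAt_id t).const_mul (deriv k 0))
    exact this.congr_deriv (by simp)
  · exact Eventually.of_forall fun t => by simpa using hasDerivAt_pow 2 t
  · filter_upwards [self_mem_nhdsWithin] with t ht
    simpa using ht
  · have : ContinuousAt (fun t => k t - k 0 - deriv k 0 * t) 0 :=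
      (hk.continuousAt.sub continuousAt_const).sub (by fun_prop)
    have h2 := this.tendsto.mono_left (nhdsWithin_le_nhds (s := {0}ᶜ))
    simpa using h2
  · have : ContinuousAt (fun t : ℝ => t ^ 2) 0 := by fun_prop
    have h2 := this.tendsto.mono_left (nhdsWithin_le_nhds (s := {0}ᶜ))
    simpa using h2
  · refine hs.congr' ?_
    filter_upwards [self_mem_nhdsWithin] with t ht
    have ht : t ≠ 0 := ht
    rw [slope_def_field, sub_zero]
    field_simp

/-- Adding the expansions at `t` and `-t` cancels the first-order terms, leaving the second
derivative as the limit of `(k t + k (-t) - 2 * k 0) / t ^ 2`. -/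
theorem deriv_deriv_nonpos_of_midpoint {k : ℝ → ℝ} (hk : ContDiffAt ℝ 2 k 0)
    (hm : ∀ᶠ t in 𝓝[≠] 0, k t + k (-t) ≤ 2 * k 0) : deriv (deriv k) 0 ≤ 0 := by
  have h1 := tendsto_taylor_two hk
  have hneg : Tendsto (fun t : ℝ => -t) (𝓝[≠] 0) (𝓝[≠] 0) := by
    refine tendsto_nhdsWithin_iff.2 ⟨?_, ?_⟩
    · have : Tendsto (fun t : ℝ => -t) (𝓝 0) (𝓝 (-0)) := Continuous.tendsto (by fun_prop) 0
      rw [neg_zero] at this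
      exact this.mono_left nhdsWithin_le_nhds
    · filter_upwards [self_mem_nhdsWithin] with t ht
      simpa using ht
  have h2 := h1.add (h1.comp hneg)
  rw [add_halves] at h2
  refine le_of_tendsto h2 ?_
  filter_upwards [hm] with t ht
  simp only [Function.comp_apply, neg_sq, ← add_div]
  exact div_nonpos_of_nonpos_of_nonneg (by linarith) (sq_nonneg t)

end Calculus

/-! ### From the inequality along `c`-segments to MTW(0). -/

/-- The second derivative of `c` in `x`, in the direction `ξ`. -/
noncomputable def hessX (c : (𝔼 n) → (𝔼 n) → ℝ) (ξ : 𝔼 n) : (𝔼 n) × (𝔼 n) → ℝ :=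
  dirDeriv (ξ, 0) (dirDeriv (ξ, 0) (Function.uncurry c))

namespace Admissible

theorem contDiffAt_hessX (h : Admissible c X Y) {x y : 𝔼 n} (hx : x ∈ X) (hy : y ∈ Y) (ξ : 𝔼 n) :
    ContDiffAt ℝ 2 (hessX c ξ) (x, y) :=
  contDiffAt_dirDeriv (contDiffAt_dirDeriv (by norm_num; exact h.contDiffAt hx hy))

/-- Derivatives of `c(·, y)` along a parabola. -/
theorem derivs_parabola (h : Admissible c X Y) {x y : 𝔼 n} (hx : x ∈ X) (hy : y ∈ Y) (ξ ζ : 𝔼 n) :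
    ContDiffAt ℝ 2 (fun t : ℝ => c (x + t • ξ + t ^ 2 • ζ) y) 0 ∧
    deriv (fun t : ℝ => c (x + t • ξ + t ^ 2 • ζ) y) 0 = inner ℝ (gradX c x y) ξ ∧
    deriv (deriv (fun t : ℝ => c (x + t • ξ + t ^ 2 • ζ) y)) 0 =
      hessX c ξ (x, y) + 2 * inner ℝ (gradX c x y) ζ := by
  set γ : ℝ → (𝔼 n) × (𝔼 n) := fun t => (x + t • ξ + t ^ 2 • ζ, y) with hγ
  have hγ0 : γ 0 = (x, y) := by simp [hγ]
  have hγc : ContDiffAt ℝ 2 γ 0 := by simp only [hγ]; fun_prop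
  have hd1 : ∀ t, HasDerivAt γ (ξ + (2 * t) • ζ, 0) t := by
    intro t
    refine HasDerivAt.prodMk ?_ (hasDerivAt_const t y)
    have h1 := (((hasDerivAt_id t).smul_const ξ).const_add x).add
      ((hasDerivAt_pow 2 t).smul_const ζ)
    exact h1.congr_deriv (by simp)
  have hd : deriv γ = fun t => (ξ + (2 * t) • ζ, 0) := funext fun t => (hd1 t).deriv
  have hd2 : deriv (deriv γ) 0 = ((2 : ℝ) • ζ, 0) := by
    rw [hd]
    refine HasDerivAt.deriv (HasDerivAt.prodMk ?_ (hasDerivAt_const _ _))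
    simpa using (((hasDerivAt_id (0 : ℝ)).const_mul 2).smul_const ζ).const_add ξ
  have hU : ContDiffAt ℝ 2 (Function.uncurry c) (γ 0) := by
    rw [hγ0]; exact (h.contDiffAt hx hy).of_le (by norm_num)
  have hd0 : deriv γ 0 = (ξ, 0) := by simp [hd]
  refine ⟨hU.comp 0 hγc, ?_, ?_⟩
  · have := (hasDerivAt_comp_curve (hU.differentiableAt (by norm_num))
      (hγc.differentiableAt (by norm_num))).deriv
    rw [hd0, hγ0, dirDeriv, ← h.inner_gradX hx hy] at this
    exact this
  · have := deriv_deriv_comp_curve hU hγc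
    rw [hd0, hγ0, hd2] at this
    refine this.trans ?_
    rw [hessX, ← inner_smul_right, h.inner_gradX hx hy]
    rfl

theorem iteratedDeriv_two_line (h : Admissible c X Y) {x y : 𝔼 n} (hx : x ∈ X) (hy : y ∈ Y)
    (ξ : 𝔼 n) : iteratedDeriv 2 (fun t : ℝ => c (x + t • ξ) y) 0 = hessX c ξ (x, y) := by
  have := (h.derivs_parabola hx hy ξ 0).2.2
  simpa [iteratedDeriv_two] using this

theorem eventually_mem_image (h : Admissible c X Y) {x y : 𝔼 n} (hx : x ∈ X) (hy : y ∈ Y)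
    (η : 𝔼 n) : ∀ᶠ s : ℝ in 𝓝 0, -gradX c x y + s • η ∈ (fun y => -gradX c x y) '' Y := by
  have hc : ContinuousAt (fun s : ℝ => -gradX c x y + s • η) 0 := by fun_prop
  refine hc.eventually ((h.isOpen_image_gradX hx).mem_nhds ?_)
  simpa using mem_image_of_mem (fun y => -gradX c x y) hy

theorem contDiffAt_cExp_line (h : Admissible c X Y) {x y : 𝔼 n} (hx : x ∈ X) (hy : y ∈ Y)
    (η : 𝔼 n) : ContDiffAt ℝ 3 (fun s : ℝ => cExp c Y x (-gradX c x y + s • η)) 0 := by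
  refine ContDiffAt.comp (f := fun s : ℝ => -gradX c x y + s • η) 0 ?_ (by fun_prop)
  refine h.contDiffAt_cExp hx ?_
  simpa using mem_image_of_mem (fun y => -gradX c x y) hy

theorem cExp_line_zero (h : Admissible c X Y) {x y : 𝔼 n} (hx : x ∈ X) (hy : y ∈ Y)
    (η : 𝔼 n) : cExp c Y x (-gradX c x y + (0 : ℝ) • η) = y := by
  rw [zero_smul, add_zero, h.cExp_neg_gradX hx hy]

theorem mtw_quantity_eq (h : Admissible c X Y) {x y : 𝔼 n} (hx : x ∈ X) (hy : y ∈ Y)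
    (ξ η : 𝔼 n) :
    iteratedDeriv 2 (fun s : ℝ => iteratedDeriv 2
      (fun t : ℝ => c (x + t • ξ) (cExp c Y x (-gradX c x y + s • η))) 0) 0 =
    deriv (deriv fun s : ℝ => hessX c ξ (x, cExp c Y x (-gradX c x y + s • η))) 0 := by
  rw [← iteratedDeriv_two fun s : ℝ => hessX c ξ (x, cExp c Y x (-gradX c x y + s • η))]
  refine Filter.EventuallyEq.iteratedDeriv_eq 2 ?_
  filter_upwards [h.eventually_mem_image hx hy η] with s hs
  exact h.iteratedDeriv_two_line hx (h.cExp_mem hx hs).1 ξ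

theorem mtwZero_of_cSegInequality (h : Admissible c X Y) (hseg : CSegInequality c X Y) :
    MTWZero c X Y := by
  intro x hx y hy ξ η hξη
  rw [h.mtw_quantity_eq hx hy]
  set w : ℝ → 𝔼 n := fun s => cExp c Y x (-gradX c x y + s • η) with hw
  have hw0 : w 0 = y := h.cExp_line_zero hx hy η
  have hwc : ContDiffAt ℝ 2 w 0 := (h.contDiffAt_cExp_line hx hy η).of_le (by norm_num)
  refine deriv_deriv_nonpos_of_midpoint ?_ ?_
  · refine ContDiffAt.comp (f := fun s => (x, w s)) 0 ?_ (contDiffAt_const.prodMk hwc)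
    rw [hw0]
    exact h.contDiffAt_hessX hx hy ξ
  have hev := h.eventually_mem_image hx hy η
  have hevn : ∀ᶠ s : ℝ in 𝓝 0, -gradX c x y + (-s) • η ∈ (fun y => -gradX c x y) '' Y := by
    have : Tendsto (fun t : ℝ => -t) (𝓝 0) (𝓝 (-0)) := Continuous.tendsto (by fun_prop) 0
    rw [neg_zero] at this
    exact this.eventually hev
  filter_upwards [nhdsWithin_le_nhds hev, nhdsWithin_le_nhds hevn, self_mem_nhdsWithin]
    with s hs hsn hs0
  replace hs0 : s ≠ 0 := hs0
  rcases eq_or_ne η 0 with rfl | hη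
  · simp only [smul_zero, add_zero]
    linarith
  obtain ⟨hwY, hwg⟩ := h.cExp_mem hx hs
  obtain ⟨hwYn, hwgn⟩ := h.cExp_mem hx hsn
  -- This `a` makes the second-order coefficients along the parabola equal for `w s` and `w (-s)`.
  -- The minimum in the inequality then becomes the average of the two Hessians, up to a term common
  -- to both sides.
  set a : ℝ := (hessX c ξ (x, w s) - hessX c ξ (x, w (-s))) / (4 * s * ‖η‖ ^ 2) with ha
  have hηn : ‖η‖ ≠ 0 := norm_ne_zero_iff.2 hη
  have hmid : cSeg c Y x (w s) (w (-s)) (1 / 2) = y := by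
    have : pSeg c x (w s) (w (-s)) (1 / 2) = -gradX c x y := by
      rw [pSeg, hwg, hwgn]
      module
    rw [cSeg, this, h.cExp_neg_gradX hx hy]
  have hexp : ∀ v ∈ Y, Tendsto (fun t : ℝ => (c (x + t • ξ + t ^ 2 • (a • η)) v - c x v -
      inner ℝ (gradX c x v) ξ * t) / t ^ 2) (𝓝[≠] 0)
      (𝓝 ((hessX c ξ (x, v) + 2 * inner ℝ (gradX c x v) (a • η)) / 2)) := by
    intro v hv
    obtain ⟨h1, h2, h3⟩ := h.derivs_parabola hx hv ξ (a • η)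
    have := tendsto_taylor_two h1
    rw [h2, h3] at this
    simpa using this
  have hgw : gradX c x (w s) = gradX c x y - s • η := by
    rw [← neg_neg (gradX c x (w s)), show -gradX c x (w s) = -gradX c x y + s • η from hwg]
    module
  have hgwn : gradX c x (w (-s)) = gradX c x y + s • η := by
    rw [← neg_neg (gradX c x (w (-s))),
      show -gradX c x (w (-s)) = -gradX c x y + (-s) • η from hwgn]
    module
  have e0 := hexp y hy
  have e1 := hexp _ hwY
  have e2 := hexp _ hwYn
  have hball : ∀ᶠ t : ℝ in 𝓝[≠] 0, x + t • ξ + t ^ 2 • (a • η) ∈ X := by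
    have hc : ContinuousAt (fun t : ℝ => x + t • ξ + t ^ 2 • (a • η)) 0 := by fun_prop
    refine nhdsWithin_le_nhds (hc.eventually (h.isOpen_left.mem_nhds ?_))
    simpa using hx
  -- As `ξ ⊥ η`, the first-order terms at `w s`, `w (-s)` and `y` coincide and can be subtracted
  -- from both sides; `y` is the midpoint of the `c`-segment.
  have hle : ∀ᶠ t : ℝ in 𝓝[≠] 0, min
      ((c (x + t • ξ + t ^ 2 • (a • η)) (w s) - c x (w s) -
        inner ℝ (gradX c x (w s)) ξ * t) / t ^ 2)
      ((c (x + t • ξ + t ^ 2 • (a • η)) (w (-s)) - c x (w (-s)) -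
        inner ℝ (gradX c x (w (-s))) ξ * t) / t ^ 2) ≤
      (c (x + t • ξ + t ^ 2 • (a • η)) y - c x y - inner ℝ (gradX c x y) ξ * t) / t ^ 2 := by
    filter_upwards [hball, self_mem_nhdsWithin] with t ht ht0
    have ht2 : 0 < t ^ 2 := by
      have : t ≠ 0 := ht0
      positivity
    have := hseg x hx _ hwY _ hwYn (h.cSegIn hx hwY hwYn) _ ht (1 / 2) (by norm_num)
    have horth : inner ℝ η ξ = 0 := by rw [real_inner_comm]; exact hξη
    have i1 : inner ℝ (gradX c x (w s)) ξ = inner ℝ (gradX c x y) ξ := by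
      rw [hgw, inner_sub_left, inner_smul_left, horth, mul_zero, sub_zero]
    have i2 : inner ℝ (gradX c x (w (-s))) ξ = inner ℝ (gradX c x y) ξ := by
      rw [hgwn, inner_add_left, inner_smul_left, horth, mul_zero, add_zero]
    rw [i1, i2, hmid] at *
    rw [min_div_div_right ht2.le, min_sub_sub_right]
    gcongr
  have hfin := le_of_tendsto_of_tendsto (e1.min e2) e0 hle
  have hself : inner ℝ η η = ‖η‖ ^ 2 := real_inner_self_eq_norm_sq η
  have j1 : inner ℝ (gradX c x (w s)) (a • η) =
      inner ℝ (gradX c x y) (a • η) - s * (a * ‖η‖ ^ 2) := by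
    rw [hgw, inner_sub_left, inner_smul_left, inner_smul_right η η, hself]; simp
  have j2 : inner ℝ (gradX c x (w (-s))) (a • η) =
      inner ℝ (gradX c x y) (a • η) + s * (a * ‖η‖ ^ 2) := by
    rw [hgwn, inner_add_left, inner_smul_left, inner_smul_right η η, hself]; simp
  have j3 : s * (a * ‖η‖ ^ 2) = (hessX c ξ (x, w s) - hessX c ξ (x, w (-s))) / 4 := by
    rw [ha]; field_simp
  change min ((hessX c ξ (x, w s) + 2 * inner ℝ (gradX c x (w s)) (a • η)) / 2)
    ((hessX c ξ (x, w (-s)) + 2 * inner ℝ (gradX c x (w (-s))) (a • η)) / 2) ≤ _ at hfin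
  rw [j1, j2, j3] at hfin
  change hessX c ξ (x, w s) + hessX c ξ (x, w (-s)) ≤ 2 * hessX c ξ (x, w 0)
  rw [hw0]
  rcases min_le_iff.1 hfin with h1 | h1 <;> linarith

end Admissible

/-! ### Higher derivatives, derivatives along curves and a maximum principle. -/

section Calculus

variable {V : Type*} [NormedAddCommGroup V] [NormedSpace ℝ V] {g : V → ℝ} {z : V}

/-- The third derivative of `g` at `z`, applied to three vectors. -/
noncomputable def thirdDeriv (g : V → ℝ) (z u a b : V) : ℝ :=
  fderiv ℝ (fderiv ℝ (fderiv ℝ g)) z u a b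

/-- The fourth derivative of `g` at `z`, applied to four vectors. -/
noncomputable def fourthDeriv (g : V → ℝ) (z u v a b : V) : ℝ :=
  fderiv ℝ (fderiv ℝ (fderiv ℝ (fderiv ℝ g))) z u v a b

theorem thirdDeriv_add_smul_left (u a b d : V) (l : ℝ) :
    thirdDeriv g z u (a + l • b) d = thirdDeriv g z u a d + l * thirdDeriv g z u b d := by
  simp [thirdDeriv]

theorem thirdDeriv_add_smul_right (u a b d : V) (l : ℝ) :
    thirdDeriv g z u d (a + l • b) = thirdDeriv g z u d a + l * thirdDeriv g z u d b := by
  simp [thirdDeriv]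

theorem fourthDeriv_add_smul_left (u v a b d : V) (l : ℝ) :
    fourthDeriv g z u v (a + l • b) d = fourthDeriv g z u v a d + l * fourthDeriv g z u v b d := by
  simp [fourthDeriv]

theorem fourthDeriv_add_smul_right (u v a b d : V) (l : ℝ) :
    fourthDeriv g z u v d (a + l • b) = fourthDeriv g z u v d a + l * fourthDeriv g z u v d b := by
  simp [fourthDeriv]

theorem continuousAt_thirdDeriv {A : Type*} [TopologicalSpace A] {z u a b : A → V} {p : A}
    (hg : ContDiffAt ℝ 3 g (z p)) (hz : ContinuousAt z p) (hu : ContinuousAt u p)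
    (ha : ContinuousAt a p) (hb : ContinuousAt b p) :
    ContinuousAt (fun r => thirdDeriv g (z r) (u r) (a r) (b r)) p := by
  have h3 := ((hg.fderiv_right (m := 2) (by norm_num)).fderiv_right (m := 1)
    (by norm_num)).fderiv_right (m := 0) (by norm_num)
  exact (((ContinuousAt.comp (f := z) h3.continuousAt hz).clm_apply hu).clm_apply ha).clm_apply hb

theorem continuousAt_fourthDeriv {A : Type*} [TopologicalSpace A] {z u v a b : A → V} {p : A}
    (hg : ContDiffAt ℝ 4 g (z p)) (hz : ContinuousAt z p) (hu : ContinuousAt u p)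
    (hv : ContinuousAt v p) (ha : ContinuousAt a p) (hb : ContinuousAt b p) :
    ContinuousAt (fun r => fourthDeriv g (z r) (u r) (v r) (a r) (b r)) p := by
  have h3 := (((hg.fderiv_right (m := 3) (by norm_num)).fderiv_right (m := 2)
    (by norm_num)).fderiv_right (m := 1) (by norm_num)).fderiv_right (m := 0) (by norm_num)
  exact ((((ContinuousAt.comp (f := z) h3.continuousAt hz).clm_apply hu).clm_apply hv).clm_apply
    ha).clm_apply hb

theorem dirDeriv_dirDeriv_dirDeriv_eq (hg : ContDiffAt ℝ 3 g z) (u a b : V) :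
    dirDeriv u (dirDeriv a (dirDeriv b g)) z = thirdDeriv g z u a b := by
  have h1 : dirDeriv a (dirDeriv b g) =ᶠ[𝓝 z] fun z => fderiv ℝ (fderiv ℝ g) z a b := by
    filter_upwards [hg.eventually (by norm_num)] with y hy
    exact (fderiv_fderiv_apply (hy.of_le (by norm_num))).symm
  rw [(dirDeriv_congr h1).eq_of_nhds, dirDeriv]
  have hd : DifferentiableAt ℝ (fderiv ℝ (fderiv ℝ g)) z :=
    ((hg.fderiv_right (m := 2) (by norm_num)).fderiv_right (m := 1)
      (by norm_num)).differentiableAt (by norm_num)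
  rw [((hd.hasFDerivAt.clm_apply (hasFDerivAt_const a z)).clm_apply
    (hasFDerivAt_const b z)).fderiv]
  simp [thirdDeriv]

theorem dirDeriv_dirDeriv_dirDeriv_dirDeriv_eq (hg : ContDiffAt ℝ 4 g z) (u v a b : V) :
    dirDeriv u (dirDeriv v (dirDeriv a (dirDeriv b g))) z =
      fourthDeriv g z u v a b := by
  have h1 : dirDeriv v (dirDeriv a (dirDeriv b g)) =ᶠ[𝓝 z]
      fun z => fderiv ℝ (fderiv ℝ (fderiv ℝ g)) z v a b := by
    filter_upwards [hg.eventually (by norm_num)] with y hy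
    exact dirDeriv_dirDeriv_dirDeriv_eq (hy.of_le (by norm_num)) v a b
  rw [(dirDeriv_congr h1).eq_of_nhds, dirDeriv]
  have hd : DifferentiableAt ℝ (fderiv ℝ (fderiv ℝ (fderiv ℝ g))) z :=
    (((hg.fderiv_right (m := 3) (by norm_num)).fderiv_right (m := 2)
      (by norm_num)).fderiv_right (m := 1) (by norm_num)).differentiableAt (by norm_num)
  rw [(((hd.hasFDerivAt.clm_apply (hasFDerivAt_const v z)).clm_apply
    (hasFDerivAt_const a z)).clm_apply (hasFDerivAt_const b z)).fderiv]
  simp [fourthDeriv]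

variable {W : Type*} [NormedAddCommGroup W] [NormedSpace ℝ W]

theorem deriv_deriv_comp_left {g : V × W → ℝ} {γ : ℝ → V} {s : ℝ} {y : W}
    (hg : ContDiffAt ℝ 2 g (γ s, y)) (hγ : ContDiffAt ℝ 2 γ s) :
    deriv (deriv (fun s => g (γ s, y))) s =
      dirDeriv (deriv γ s, 0) (dirDeriv (deriv γ s, 0) g) (γ s, y) +
        dirDeriv (deriv (deriv γ) s, 0) g (γ s, y) := by
  have h1 : deriv (fun s => (γ s, y)) =ᶠ[𝓝 s] fun s => (deriv γ s, 0) := by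
    filter_upwards [hγ.eventually (by norm_num)] with r hr
    exact ((hr.differentiableAt (by norm_num)).hasDerivAt.prodMk (hasDerivAt_const r y)).deriv
  have h2 : deriv (deriv (fun s => (γ s, y))) s = (deriv (deriv γ) s, 0) := by
    rw [h1.deriv_eq]
    exact (((contDiffAt_deriv (k := 1) (by norm_num; exact hγ)).differentiableAt
      (by norm_num)).hasDerivAt.prodMk (hasDerivAt_const s 0)).deriv
  have := deriv_deriv_comp_curve (γ := fun s => (γ s, y)) hg (hγ.prodMk contDiffAt_const)
  rwa [h1.eq_of_nhds, h2] at this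

theorem deriv_deriv_comp_right {g : V × W → ℝ} {γ : ℝ → W} {s : ℝ} {x : V}
    (hg : ContDiffAt ℝ 2 g (x, γ s)) (hγ : ContDiffAt ℝ 2 γ s) :
    deriv (deriv (fun s => g (x, γ s))) s =
      dirDeriv (0, deriv γ s) (dirDeriv (0, deriv γ s) g) (x, γ s) +
        dirDeriv (0, deriv (deriv γ) s) g (x, γ s) := by
  have h1 : deriv (fun s => (x, γ s)) =ᶠ[𝓝 s] fun s => (0, deriv γ s) := by
    filter_upwards [hγ.eventually (by norm_num)] with r hr
    exact ((hasDerivAt_const r x).prodMk (hr.differentiableAt (by norm_num)).hasDerivAt).deriv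
  have h2 : deriv (deriv (fun s => (x, γ s))) s = (0, deriv (deriv γ) s) := by
    rw [h1.deriv_eq]
    exact ((hasDerivAt_const s 0).prodMk ((contDiffAt_deriv (k := 1)
      (by norm_num; exact hγ)).differentiableAt (by norm_num)).hasDerivAt).deriv
  have := deriv_deriv_comp_curve (γ := fun s => (x, γ s)) hg (contDiffAt_const.prodMk hγ)
  rwa [h1.eq_of_nhds, h2] at this

theorem hasDerivAt_comp_left {g : V × W → ℝ} {γ : ℝ → V} {s : ℝ} {y : W}
    (hg : DifferentiableAt ℝ g (γ s, y)) (hγ : DifferentiableAt ℝ γ s) :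
    HasDerivAt (fun s => g (γ s, y)) (dirDeriv (deriv γ s, 0) g (γ s, y)) s :=
  hg.hasFDerivAt.comp_hasDerivAt (f := fun s => (γ s, y)) s
    (hγ.hasDerivAt.prodMk (hasDerivAt_const s y))

theorem hasDerivAt_comp_right {g : V × W → ℝ} {γ : ℝ → W} {s : ℝ} {x : V}
    (hg : DifferentiableAt ℝ g (x, γ s)) (hγ : DifferentiableAt ℝ γ s) :
    HasDerivAt (fun s => g (x, γ s)) (dirDeriv (0, deriv γ s) g (x, γ s)) s :=
  hg.hasFDerivAt.comp_hasDerivAt (f := fun s => (x, γ s)) s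
    ((hasDerivAt_const s x).prodMk hγ.hasDerivAt)

theorem deriv_deriv_eq_zero_of_affine {k : ℝ → ℝ} {s a b : ℝ}
    (hk : ∀ᶠ r in 𝓝 s, k r = a + r * b) : deriv (deriv k) s = 0 := by
  have h1 : k =ᶠ[𝓝 s] fun r => a + r * b := hk
  have h2 : deriv (fun r : ℝ => a + r * b) = fun _ => b := by
    funext r
    simp
  rw [h1.deriv.deriv_eq, h2, deriv_const]

theorem sub_le_of_deriv_deriv_le {f : ℝ → ℝ} {K : ℝ} (hK : 0 ≤ K)
    (hf : ∀ s ∈ Icc (0 : ℝ) 1, ContDiffAt ℝ 2 f s) (h0 : deriv f 0 = 0)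
    (h2 : ∀ s ∈ Icc (0 : ℝ) 1, deriv (deriv f) s ≤ K) : f 1 - f 0 ≤ K := by
  have hd : ∀ s ∈ Icc (0 : ℝ) 1, ContDiffAt ℝ 1 (deriv f) s := fun s hs =>
    contDiffAt_deriv (by norm_num; exact hf s hs)
  have h1 : ∀ s ∈ Icc (0 : ℝ) 1, deriv f s ≤ K := by
    intro s hs
    have := (convex_Icc (0 : ℝ) 1).image_sub_le_mul_sub_of_deriv_le
      (fun r hr => (hd r hr).continuousAt.continuousWithinAt)
      (fun r hr => ((hd r (interior_subset hr)).differentiableAt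
        (by norm_num)).differentiableWithinAt)
      (fun r hr => h2 r (interior_subset hr)) 0 (by simp) s hs hs.1
    rw [h0, sub_zero, sub_zero] at this
    exact this.trans (mul_le_of_le_one_right hK hs.2)
  have := (convex_Icc (0 : ℝ) 1).image_sub_le_mul_sub_of_deriv_le
    (fun r hr => (hf r hr).continuousAt.continuousWithinAt)
    (fun r hr => ((hf r (interior_subset hr)).differentiableAt
      (by norm_num)).differentiableWithinAt)
    (fun r hr => h1 r (interior_subset hr)) 0 (by simp) 1 (by simp) zero_le_one
  simpa using this

theorem deriv_deriv_nonpos_of_isLocalMax {k : ℝ → ℝ} {s : ℝ} (hk : ContDiffAt ℝ 2 k s)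
    (hm : IsLocalMax k s) : deriv (deriv k) s ≤ 0 := by
  have h1 : ContDiffAt ℝ 2 (fun t => k (s + t)) 0 := by
    refine ContDiffAt.comp (f := fun t => s + t) 0 ?_ (by fun_prop)
    simpa using hk
  have h2 : deriv (deriv fun t => k (s + t)) 0 = deriv (deriv k) s := by
    have : (deriv fun t => k (s + t)) = fun t => deriv k (s + t) :=
      funext fun t => deriv_comp_const_add k s t
    rw [this, deriv_comp_const_add, add_zero]
  rw [← h2]
  refine deriv_deriv_nonpos_of_midpoint h1 (nhdsWithin_le_nhds ?_)
  have c1 : Tendsto (fun t => s + t) (𝓝 0) (𝓝 (s + 0)) := Continuous.tendsto (by fun_prop) 0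
  have c2 : Tendsto (fun t => s + -t) (𝓝 0) (𝓝 (s + -0)) := Continuous.tendsto (by fun_prop) 0
  rw [add_zero] at c1
  rw [neg_zero, add_zero] at c2
  filter_upwards [c1.eventually hm, c2.eventually hm] with t ht1 ht2
  rw [add_zero]
  linarith

/-- A function on `[0, 1]` with `h'' ≥ -C |h'|` is bounded by its values at the end points. -/
theorem le_max_of_deriv_deriv_ge {h : ℝ → ℝ} {C : ℝ}
    (hh : ∀ t ∈ Icc (0 : ℝ) 1, ContDiffAt ℝ 2 h t)
    (h2 : ∀ t ∈ Icc (0 : ℝ) 1, -(C * |deriv h t|) ≤ deriv (deriv h) t) {t : ℝ}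
    (ht : t ∈ Icc (0 : ℝ) 1) : h t ≤ max (h 0) (h 1) := by
  by_contra! hlt
  set K : ℝ := |C| + 1 with hK
  have hK0 : 0 < K := by positivity
  -- `δ` is small enough that `h + e` with `e t = δ * exp (t * K)` still has its maximum inside.
  -- There `h' = -K e` and `h'' ≤ -K² e`, while `h'' ≥ -C K e`; this contradicts `K > C`.
  set δ : ℝ := (h t - max (h 0) (h 1)) / (2 * Real.exp K) with hδ
  have hδ0 : 0 < δ := div_pos (by linarith) (by positivity)
  have hδK : δ * Real.exp K < h t - max (h 0) (h 1) := by
    have : δ * Real.exp K = (h t - max (h 0) (h 1)) / 2 := by rw [hδ]; field_simp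
    linarith
  set e : ℝ → ℝ := fun t => δ * Real.exp (t * K) with he
  have hde : ∀ t, HasDerivAt e (K * e t) t := by
    intro t
    have := (((hasDerivAt_id t).mul_const K).exp).const_mul δ
    refine this.congr_deriv ?_
    simp only [he, id]; ring
  have hde' : deriv e = fun t => K * e t := funext fun t => (hde t).deriv
  have hdde : ∀ t, deriv (fun t => K * e t) t = K * (K * e t) := fun t =>
    ((hde t).const_mul K).deriv
  have he0 : ∀ t, 0 < e t := fun t => by positivity
  have heC : ∀ t, ContDiffAt ℝ 2 e t := fun t => by simp only [he]; fun_prop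
  have hmC : ∀ t ∈ Icc (0 : ℝ) 1, ContDiffAt ℝ 2 (fun t => h t + e t) t := fun t ht =>
    (hh t ht).add (heC t)
  obtain ⟨r, hr, hmax⟩ := isCompact_Icc.exists_isMaxOn ⟨t, ht⟩
    (fun t ht => (hmC t ht).continuousAt.continuousWithinAt)
  have hrt : h t < h r + e r := by
    have h1 : h t + e t ≤ h r + e r := hmax ht
    linarith [he0 t]
  have hr0 : r ≠ 0 := by
    rintro rfl
    have h3 : e 0 ≤ δ * Real.exp K := by
      simp only [he]
      gcongr
      simpa using hK0.le
    linarith [le_max_left (h 0) (h 1)]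
  have hr1 : r ≠ 1 := by
    rintro rfl
    have h3 : e 1 = δ * Real.exp K := by simp [he]
    linarith [le_max_right (h 0) (h 1)]
  have hrI : Icc (0 : ℝ) 1 ∈ 𝓝 r :=
    Icc_mem_nhds (lt_of_le_of_ne hr.1 hr0.symm) (lt_of_le_of_ne hr.2 hr1)
  have hloc : IsLocalMax (fun t => h t + e t) r := hmax.isLocalMax hrI
  have hd2 := deriv_deriv_nonpos_of_isLocalMax (hmC r hr) hloc
  have hd1 := hloc.deriv_eq_zero
  have hderiv : deriv (fun t => h t + e t) =ᶠ[𝓝 r] fun t => deriv h t + K * e t := by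
    filter_upwards [hrI] with t ht
    exact (((hh t ht).differentiableAt (by norm_num)).hasDerivAt.add (hde t)).deriv
  rw [hderiv.eq_of_nhds] at hd1
  have hdd : deriv (deriv fun t => h t + e t) r = deriv (deriv h) r + K * (K * e r) := by
    rw [hderiv.deriv_eq]
    exact (((contDiffAt_deriv (k := 1) (by norm_num; exact hh r hr)).differentiableAt
      (by norm_num)).hasDerivAt.add ((hde r).const_mul K)).deriv
  rw [hdd] at hd2
  have h3 := h2 r hr
  have h4 : deriv h r = -(K * e r) := by linarith
  have hKe : 0 < K * e r := mul_pos hK0 (he0 r)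
  rw [h4, abs_neg, abs_of_pos hKe] at h3
  nlinarith [le_abs_self C, mul_le_mul_of_nonneg_right (le_abs_self C) hKe.le]

/-- The first and second partial derivatives in the first variable, along a horizontal line. -/
theorem derivs_horizontal {F : ℝ × ℝ → V} {s t : ℝ} (hF : ContDiffAt ℝ 3 F (s, t)) :
    ContDiffAt ℝ 3 (fun r => F (r, t)) s ∧
    deriv (fun r => F (r, t)) s = fderiv ℝ F (s, t) (1, 0) ∧
    deriv (deriv fun r => F (r, t)) s =
      fderiv ℝ (fun z => fderiv ℝ F z (1, 0)) (s, t) (1, 0) := by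
  have hline : ∀ r : ℝ, HasDerivAt (fun r : ℝ => (r, t)) ((1 : ℝ), (0 : ℝ)) r := fun r =>
    (hasDerivAt_id r).prodMk (hasDerivAt_const r t)
  have hc : ContDiffAt ℝ 3 (fun r : ℝ => (r, t)) s := by fun_prop
  have hev : ∀ᶠ r in 𝓝 s, deriv (fun r => F (r, t)) r = fderiv ℝ F (r, t) (1, 0) := by
    filter_upwards [hc.continuousAt.eventually (hF.eventually (by norm_num))] with r hr
    exact ((hr.differentiableAt (by norm_num)).hasFDerivAt.comp_hasDerivAt
      (f := fun r => (r, t)) r (hline r)).deriv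
  refine ⟨hF.comp (f := fun r => (r, t)) s hc, hev.self_of_nhds, ?_⟩
  rw [EventuallyEq.deriv_eq hev]
  have hd : DifferentiableAt ℝ (fun z => fderiv ℝ F z (1, 0)) (s, t) :=
    ((hF.fderiv_right (m := 2) (by norm_num)).clm_apply contDiffAt_const).differentiableAt
      (by norm_num)
  exact (hd.hasFDerivAt.comp_hasDerivAt (f := fun r => (r, t)) s (hline s)).deriv

end Calculus

/-! ### MTW(0) along curves in `X` on which `D_y c(·, y)` is affine. -/

namespace Admissible

theorem gradX_dirDeriv_eventually (h : Admissible c X Y) {x y : 𝔼 n} (hx : x ∈ X) (hy : y ∈ Y)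
    (u : 𝔼 n) : dirDeriv (u, 0) (Function.uncurry c) =ᶠ[𝓝 (x, y)]
      fun z => inner ℝ (gradX c z.1 z.2) u := by
  filter_upwards [(h.isOpen_left.prod h.isOpen_right).mem_nhds (x := (x, y)) ⟨hx, hy⟩] with z hz
  exact (h.inner_gradX hz.1 hz.2 u).symm

theorem gradY_dirDeriv_eventually (h : Admissible c X Y) {x y : 𝔼 n} (hx : x ∈ X) (hy : y ∈ Y)
    (u : 𝔼 n) : dirDeriv (0, u) (Function.uncurry c) =ᶠ[𝓝 (x, y)]
      fun z => inner ℝ (gradY c z.1 z.2) u := by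
  filter_upwards [(h.isOpen_left.prod h.isOpen_right).mem_nhds (x := (x, y)) ⟨hx, hy⟩] with z hz
  exact (h.inner_gradY hz.1 hz.2 u).symm

theorem inner_fderiv_gradX (h : Admissible c X Y) {x y : 𝔼 n} (hx : x ∈ X) (hy : y ∈ Y)
    (v u : 𝔼 n) : inner ℝ (fderiv ℝ (gradX c x) y v) u =
      dirDeriv (0, v) (dirDeriv (u, 0) (Function.uncurry c)) (x, y) := by
  rw [(dirDeriv_congr (h.gradX_dirDeriv_eventually hx hy u)).eq_of_nhds, dirDeriv]
  have hd : DifferentiableAt ℝ (fun z : (𝔼 n) × (𝔼 n) => gradX c z.1 z.2) (x, y) :=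
    (h.contDiffAt_gradX hx hy).differentiableAt (by norm_num)
  rw [(hd.hasFDerivAt.inner ℝ (hasFDerivAt_const u (x, y))).fderiv]
  have h2 : HasFDerivAt (gradX c x)
      ((fderiv ℝ (fun z : (𝔼 n) × (𝔼 n) => gradX c z.1 z.2) (x, y)).comp
        (ContinuousLinearMap.inr ℝ (𝔼 n) (𝔼 n))) y :=
    HasFDerivAt.comp (f := fun e => (x, e)) y hd.hasFDerivAt (hasFDerivAt_prodMk_right x y)
  rw [h2.fderiv]
  simp

theorem inner_fderiv_gradY (h : Admissible c X Y) {x y : 𝔼 n} (hx : x ∈ X) (hy : y ∈ Y)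
    (a : (𝔼 n) × (𝔼 n)) (v : 𝔼 n) :
    inner ℝ (fderiv ℝ (fun z : (𝔼 n) × (𝔼 n) => gradY c z.1 z.2) (x, y) a) v =
      dirDeriv a (dirDeriv (0, v) (Function.uncurry c)) (x, y) := by
  rw [(dirDeriv_congr (h.gradY_dirDeriv_eventually hx hy v)).eq_of_nhds, dirDeriv]
  have hd : DifferentiableAt ℝ (fun z : (𝔼 n) × (𝔼 n) => gradY c z.1 z.2) (x, y) :=
    (h.contDiffAt_gradY hx hy).differentiableAt (by norm_num)
  rw [(hd.hasFDerivAt.inner ℝ (hasFDerivAt_const v (x, y))).fderiv]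
  simp

theorem contDiffAt_two (h : Admissible c X Y) {x y : 𝔼 n} (hx : x ∈ X) (hy : y ∈ Y) :
    ContDiffAt ℝ 2 (Function.uncurry c) (x, y) :=
  (h.contDiffAt hx hy).of_le (by norm_num)

theorem contDiffAt_three (h : Admissible c X Y) {x y : 𝔼 n} (hx : x ∈ X) (hy : y ∈ Y) :
    ContDiffAt ℝ 3 (Function.uncurry c) (x, y) :=
  (h.contDiffAt hx hy).of_le (by norm_num)

theorem contDiffAt_dirDeriv_cost (h : Admissible c X Y) {x y : 𝔼 n} (hx : x ∈ X) (hy : y ∈ Y)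
    (a : (𝔼 n) × (𝔼 n)) : ContDiffAt ℝ 2 (dirDeriv a (Function.uncurry c)) (x, y) :=
  contDiffAt_dirDeriv (by norm_num; exact h.contDiffAt_three hx hy)

theorem contDiffAt_dirDeriv_dirDeriv_cost (h : Admissible c X Y) {x y : 𝔼 n} (hx : x ∈ X)
    (hy : y ∈ Y) (a b : (𝔼 n) × (𝔼 n)) :
    ContDiffAt ℝ 2 (dirDeriv a (dirDeriv b (Function.uncurry c))) (x, y) :=
  contDiffAt_dirDeriv (contDiffAt_dirDeriv (by norm_num; exact h.contDiffAt hx hy))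

/-- Along a curve in `X` on which `D_y c(·, y)` is affine, the second derivatives of the partial
derivatives of `c` in `y` vanish. -/
theorem affine_left (h : Admissible c X Y) {γ : ℝ → 𝔼 n} {s : ℝ} {y q w : 𝔼 n} (hx : γ s ∈ X)
    (hy : y ∈ Y) (hγ : ContDiffAt ℝ 2 γ s) (hq : ∀ᶠ r in 𝓝 s, gradY c (γ r) y = q + r • w)
    (u : 𝔼 n) :
    deriv (deriv (fun r => dirDeriv (0, u) (Function.uncurry c) (γ r, y))) s = 0 ∧
    dirDeriv (deriv γ s, 0) (dirDeriv (0, u) (Function.uncurry c)) (γ s, y) = inner ℝ w u := by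
  have hev : ∀ᶠ r in 𝓝 s, dirDeriv (0, u) (Function.uncurry c) (γ r, y) =
      inner ℝ q u + r * inner ℝ w u := by
    filter_upwards [hq, hγ.continuousAt.eventually (h.isOpen_left.mem_nhds hx)] with r hr hrX
    rw [dirDeriv, ← h.inner_gradY hrX hy, hr, inner_add_left, inner_smul_left]
    simp
  refine ⟨deriv_deriv_eq_zero_of_affine hev, ?_⟩
  have h1 := (hasDerivAt_comp_left ((h.contDiffAt_dirDeriv_cost hx hy (0, u)).differentiableAt
    (by norm_num)) (hγ.differentiableAt (by norm_num))).deriv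
  rw [← h1, EventuallyEq.deriv_eq hev]
  simp

theorem affine_right (h : Admissible c X Y) {γ : ℝ → 𝔼 n} {s : ℝ} {x q w : 𝔼 n} (hx : x ∈ X)
    (hy : γ s ∈ Y) (hγ : ContDiffAt ℝ 2 γ s) (hq : ∀ᶠ r in 𝓝 s, gradX c x (γ r) = q + r • w)
    (u : 𝔼 n) :
    deriv (deriv (fun r => dirDeriv (u, 0) (Function.uncurry c) (x, γ r))) s = 0 := by
  refine deriv_deriv_eq_zero_of_affine (a := inner ℝ q u) (b := inner ℝ w u) ?_
  filter_upwards [hq, hγ.continuousAt.eventually (h.isOpen_right.mem_nhds hy)] with r hr hrY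
  rw [dirDeriv, ← h.inner_gradX hx hrY, hr, inner_add_left, inner_smul_left]
  simp

/-- The condition MTW(0), transferred to curves in `X` on which `D_y c(·, y)` is affine. -/
theorem mtw_dual (h : Admissible c X Y) (hmtw : MTWZero c X Y) {γ : ℝ → 𝔼 n} {s : ℝ}
    {y q w v : 𝔼 n} (hx : γ s ∈ X) (hy : y ∈ Y) (hγ : ContDiffAt ℝ 2 γ s)
    (hq : ∀ᶠ r in 𝓝 s, gradY c (γ r) y = q + r • w) (hwv : inner ℝ w v = 0) :
    dirDeriv (deriv γ s, 0) (dirDeriv (deriv γ s, 0)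
        (dirDeriv (0, v) (dirDeriv (0, v) (Function.uncurry c)))) (γ s, y) +
      dirDeriv (deriv (deriv γ) s, 0)
        (dirDeriv (0, v) (dirDeriv (0, v) (Function.uncurry c))) (γ s, y) ≤ 0 := by
  set x := γ s with hxdef
  set ξ := deriv γ s with hξ
  set ζ := deriv (deriv γ) s with hζ
  set U := Function.uncurry c with hU
  -- With this `η` the curve `s ↦ cexp_x(p + sη)` has velocity `v` at `0`. The condition `ξ ⊥ η`
  -- becomes `w ⊥ v`, because the mixed derivative of `c` applied to `ξ` and `v` is `w · v`.
  set η := -fderiv ℝ (gradX c x) y v with hη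
  have horth : inner ℝ ξ η = 0 := by
    rw [hη, inner_neg_right, real_inner_comm, h.inner_fderiv_gradX hx hy,
      dirDeriv_comm (h.contDiffAt_two hx hy), (h.affine_left hx hy hγ hq v).2, hwv, neg_zero]
  have hm := hmtw x hx y hy ξ η horth
  rw [h.mtw_quantity_eq hx hy] at hm
  set σ : ℝ → 𝔼 n := fun r => cExp c Y x (-gradX c x y + r • η) with hσ
  have hσ0 : σ 0 = y := h.cExp_line_zero hx hy η
  have hσY : σ 0 ∈ Y := by rw [hσ0]; exact hy
  have hσc : ContDiffAt ℝ 2 σ 0 := (h.contDiffAt_cExp_line hx hy η).of_le (by norm_num)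
  have hσq : ∀ᶠ r in 𝓝 0, gradX c x (σ r) = gradX c x y + r • (-η) := by
    filter_upwards [h.eventually_mem_image hx hy η] with r hr
    rw [← neg_neg (gradX c x (σ r)),
      show -gradX c x (σ r) = -gradX c x y + r • η from (h.cExp_mem hx hr).2]
    module
  have hσ1 : deriv σ 0 = v := by
    refine h.injective_fderiv_gradX hx hy ?_
    have h1 : HasDerivAt (fun r => gradX c x (σ r)) (fderiv ℝ (gradX c x) y (deriv σ 0)) 0 := by
      have hd : DifferentiableAt ℝ (gradX c x) (σ 0) :=
        (h.contDiffAt_gradX_right hx hσY).differentiableAt (by norm_num)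
      have := hd.hasFDerivAt.comp_hasDerivAt (0 : ℝ)
        (hσc.differentiableAt (by norm_num)).hasDerivAt
      rwa [hσ0] at this
    have h2 : HasDerivAt (fun r : ℝ => gradX c x y + r • (-η)) (-η) 0 := by
      simpa using ((hasDerivAt_id (0 : ℝ)).smul_const (-η)).const_add (gradX c x y)
    rw [← h1.deriv, EventuallyEq.deriv_eq hσq, h2.deriv, hη, neg_neg]
  set θ := deriv (deriv σ) 0 with hθ
  have hm2 := deriv_deriv_comp_right (g := hessX c ξ) (x := x) (γ := σ) (s := 0)
    (by rw [hσ0]; exact h.contDiffAt_hessX hx hy ξ) hσc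
  rw [hm2, hσ0, hσ1] at hm
  -- MTW(0) carries the acceleration term `∂_θ∂_ξ∂_ξ c`, the claim carries `∂_ζ∂_v∂_v c`. By the
  -- affinity of `D_x c` along `σ` and of `D_y c` along `γ`, each equals `-∂_ζ∂_θ c`, so the two
  -- expressions agree.
  have a1 := deriv_deriv_comp_right (g := dirDeriv (ζ, 0) U) (x := x) (γ := σ) (s := 0)
    (h.contDiffAt_dirDeriv_cost hx hσY _) hσc
  rw [h.affine_right hx hσY hσc hσq ζ, hσ0, hσ1] at a1
  have a2 := deriv_deriv_comp_left (g := dirDeriv (0, θ) U) (y := y) (γ := γ) (s := s)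
    (h.contDiffAt_dirDeriv_cost hx hy _) hγ
  rw [(h.affine_left hx hy hγ hq θ).1] at a2
  rw [← hxdef, ← hξ, ← hζ] at a2
  have c1 := dirDeriv_comm (u := (ζ, 0)) (v := (0, θ)) (h.contDiffAt_two hx hy)
  have c2 := dirDeriv_comm₃ (u := (ζ, 0)) (v := (0, v)) (h.contDiffAt_three hx hy)
  have c3 := dirDeriv_comm₃ (u := (0, θ)) (v := (ξ, 0)) (h.contDiffAt_three hx hy)
  have c4 := dirDeriv_comm₄ (u := (ξ, 0)) (v := (0, v)) (h.contDiffAt hx hy)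
  rw [hessX, c3, ← c4] at hm
  rw [c2]
  linarith

/-- The derivative of `D_y c` in `x` is the transpose of that of `D_x c` in `y`: a vector in its
kernel is orthogonal to the range of the latter, which is everything by (C3). -/
theorem injective_fderiv_gradY_prod (h : Admissible c X Y) {x y : 𝔼 n} (hx : x ∈ X) (hy : y ∈ Y) :
    Function.Injective ((fderiv ℝ (fun z : (𝔼 n) × (𝔼 n) => gradY c z.1 z.2) (x, y)).prod
      (ContinuousLinearMap.snd ℝ (𝔼 n) (𝔼 n))) := by
  rw [injective_iff_map_eq_zero]
  rintro ⟨u, v⟩ huv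
  simp only [ContinuousLinearMap.prod_apply, ContinuousLinearMap.coe_snd', Prod.mk_eq_zero] at huv
  obtain ⟨h1, rfl⟩ := huv
  have h2 : ∀ w, inner ℝ (fderiv ℝ (gradX c x) y w) u = 0 := fun w => by
    rw [h.inner_fderiv_gradX hx hy, dirDeriv_comm (h.contDiffAt_two hx hy),
      ← h.inner_fderiv_gradY hx hy, h1, inner_zero_left]
  obtain ⟨w, hw⟩ := h.surjective_fderiv_gradX hx hy u
  have h3 := h2 w
  rw [hw, inner_self_eq_zero] at h3
  rw [h3]; rfl

/-- The inverse of `(x, y) ↦ (D_y c(x, y), y)`. -/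
theorem exists_smooth_inverse_gradY (h : Admissible c X Y) :
    ∃ R : (𝔼 n) × (𝔼 n) → 𝔼 n, ∀ x ∈ X, ∀ y ∈ Y, R (gradY c x y, y) = x ∧
      ContDiffAt ℝ 3 R (gradY c x y, y) ∧
      ∀ᶠ z in 𝓝 (gradY c x y, y), R z ∈ X ∧ gradY c (R z) z.2 = z.1 := by
  -- Keeping `y` as a coordinate makes the inverse smooth jointly in the slope and in `y`, as needed
  -- when `y` moves along a `c`-segment.
  set Ψ : (𝔼 n) × (𝔼 n) → (𝔼 n) × (𝔼 n) := fun z => (gradY c z.1 z.2, z.2) with hΨ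
  have hinj : InjOn Ψ (X ×ˢ Y) := by
    rintro ⟨x, y⟩ ⟨hx, hy⟩ ⟨x', y'⟩ ⟨hx', hy'⟩ heq
    simp only [hΨ, Prod.mk.injEq] at heq
    obtain ⟨h1, rfl⟩ := heq
    exact Prod.ext (h.condC2 y hy hx hx' (congrArg Neg.neg h1)) rfl
  have hleft : ∀ z ∈ X ×ˢ Y, Function.invFunOn Ψ (X ×ˢ Y) (Ψ z) = z := fun z hz =>
    hinj.leftInvOn_invFunOn hz
  refine ⟨fun z => (Function.invFunOn Ψ (X ×ˢ Y) z).1, fun x hx y hy => ?_⟩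
  have hC : ContDiffAt ℝ 3 Ψ (x, y) := (h.contDiffAt_gradY hx hy).prodMk contDiffAt_snd
  have hd : HasFDerivAt Ψ ((fderiv ℝ (fun z : (𝔼 n) × (𝔼 n) => gradY c z.1 z.2) (x, y)).prod
      (ContinuousLinearMap.snd ℝ (𝔼 n) (𝔼 n))) (x, y) :=
    ((h.contDiffAt_gradY hx hy).differentiableAt (by norm_num)).hasFDerivAt.prodMk hasFDerivAt_snd
  obtain ⟨h1, h2⟩ := image_mem_nhds_and_contDiffAt_leftInverse (k := 3) (by norm_num)
    (h.isOpen_left.prod h.isOpen_right) (x := (x, y)) ⟨hx, hy⟩ hC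
    (f' := (LinearEquiv.ofInjectiveEndo ((fderiv ℝ (fun z : (𝔼 n) × (𝔼 n) => gradY c z.1 z.2)
      (x, y)).prod (ContinuousLinearMap.snd ℝ (𝔼 n) (𝔼 n))).toLinearMap
      (h.injective_fderiv_gradY_prod hx hy)).toContinuousLinearEquiv) hd hleft
  refine ⟨congrArg Prod.fst (hleft (x, y) ⟨hx, hy⟩), contDiffAt_fst.comp _ h2, ?_⟩
  filter_upwards [h1] with z hz
  obtain ⟨a, ha, rfl⟩ := hz
  rw [hleft a ha]
  exact ⟨ha.1, rfl⟩

/-- The set `-D_x c(x, Y)` is open, so the `c`-segment extends slightly beyond `[0, 1]` and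
two-sided derivatives make sense at the end points. -/
theorem contDiffAt_cSeg (h : Admissible c X Y) {x y₀ y₁ : 𝔼 n} (hx : x ∈ X) (h₀ : y₀ ∈ Y)
    (h₁ : y₁ ∈ Y) {t : ℝ} (ht : t ∈ Icc (0 : ℝ) 1) :
    ContDiffAt ℝ 3 (cSeg c Y x y₀ y₁) t ∧ ∀ᶠ r in 𝓝 t, cSeg c Y x y₀ y₁ r ∈ Y ∧
      gradX c x (cSeg c Y x y₀ y₁ r) = gradX c x y₀ + r • (gradX c x y₁ - gradX c x y₀) := by
  have hp : ContDiff ℝ 3 (pSeg c x y₀ y₁) := by unfold pSeg; fun_prop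
  refine ⟨(h.contDiffAt_cExp hx (h.cSegIn hx h₀ h₁ t ht)).comp t hp.contDiffAt, ?_⟩
  filter_upwards [hp.continuous.continuousAt.eventually ((h.isOpen_image_gradX hx).mem_nhds
    (h.cSegIn hx h₀ h₁ t ht))] with r hr
  obtain ⟨h1, h2⟩ := h.cExp_mem hx hr
  refine ⟨h1, ?_⟩
  rw [← neg_neg (gradX c x (cSeg c Y x y₀ y₁ r)), cSeg, h2, pSeg]
  module

end Admissible

/-! ### The height function along a `c`-segment. -/

theorem deriv_deriv_add {k l : ℝ → ℝ} {s : ℝ} (hk : ContDiffAt ℝ 2 k s)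
    (hl : ContDiffAt ℝ 2 l s) :
    deriv (deriv fun r => k r + l r) s = deriv (deriv k) s + deriv (deriv l) s := by
  simpa only [iteratedDeriv_two] using iteratedDeriv_fun_add hk hl

theorem deriv_deriv_sub {k l : ℝ → ℝ} {s : ℝ} (hk : ContDiffAt ℝ 2 k s)
    (hl : ContDiffAt ℝ 2 l s) :
    deriv (deriv fun r => k r - l r) s = deriv (deriv k) s - deriv (deriv l) s := by
  simpa only [iteratedDeriv_two] using iteratedDeriv_fun_sub hk hl

/-- The second derivative of `D²_{yy} c(·, y)(a, b)` along a curve with velocity `ξ` and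
acceleration `ζ`. -/
noncomputable def crossForm (c : (𝔼 n) → (𝔼 n) → ℝ) (z : (𝔼 n) × (𝔼 n)) (ξ ζ a b : 𝔼 n) : ℝ :=
  fourthDeriv (Function.uncurry c) z (ξ, 0) (ξ, 0) (0, a) (0, b) +
    thirdDeriv (Function.uncurry c) z (ζ, 0) (0, a) (0, b)

theorem crossForm_add_smul_left (z : (𝔼 n) × (𝔼 n)) (ξ ζ a b d : 𝔼 n) (l : ℝ) :
    crossForm c z ξ ζ (a + l • b) d = crossForm c z ξ ζ a d + l * crossForm c z ξ ζ b d := by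
  have : ((0 : 𝔼 n), a + l • b) = (0, a) + l • ((0 : 𝔼 n), b) := by simp
  simp only [crossForm, this, fourthDeriv_add_smul_left, thirdDeriv_add_smul_left]
  ring

theorem crossForm_add_smul_right (z : (𝔼 n) × (𝔼 n)) (ξ ζ a b d : 𝔼 n) (l : ℝ) :
    crossForm c z ξ ζ d (a + l • b) = crossForm c z ξ ζ d a + l * crossForm c z ξ ζ d b := by
  have : ((0 : 𝔼 n), a + l • b) = (0, a) + l • ((0 : 𝔼 n), b) := by simp
  simp only [crossForm, this, fourthDeriv_add_smul_right, thirdDeriv_add_smul_right]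
  ring

namespace Admissible

theorem crossForm_eq (h : Admissible c X Y) {x y : 𝔼 n} (hx : x ∈ X) (hy : y ∈ Y)
    (ξ ζ a b : 𝔼 n) : crossForm c (x, y) ξ ζ a b =
      dirDeriv (ξ, 0) (dirDeriv (ξ, 0) (dirDeriv (0, a) (dirDeriv (0, b) (Function.uncurry c))))
        (x, y) +
      dirDeriv (ζ, 0) (dirDeriv (0, a) (dirDeriv (0, b) (Function.uncurry c))) (x, y) := by
  rw [dirDeriv_dirDeriv_dirDeriv_dirDeriv_eq (h.contDiffAt hx hy),
    dirDeriv_dirDeriv_dirDeriv_eq (h.contDiffAt_three hx hy), crossForm]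

theorem continuousAt_crossForm (h : Admissible c X Y) {A : Type*} [TopologicalSpace A]
    {z : A → (𝔼 n) × (𝔼 n)} {ξ ζ a b : A → 𝔼 n} {p : A} (hx : (z p).1 ∈ X) (hy : (z p).2 ∈ Y)
    (hz : ContinuousAt z p) (hξ : ContinuousAt ξ p) (hζ : ContinuousAt ζ p)
    (ha : ContinuousAt a p) (hb : ContinuousAt b p) :
    ContinuousAt (fun r => crossForm c (z r) (ξ r) (ζ r) (a r) (b r)) p := by
  have hξ0 : ContinuousAt (fun r => (ξ r, (0 : 𝔼 n))) p := hξ.prodMk continuousAt_const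
  have hζ0 : ContinuousAt (fun r => (ζ r, (0 : 𝔼 n))) p := hζ.prodMk continuousAt_const
  have ha0 : ContinuousAt (fun r => ((0 : 𝔼 n), a r)) p := continuousAt_const.prodMk ha
  have hb0 : ContinuousAt (fun r => ((0 : 𝔼 n), b r)) p := continuousAt_const.prodMk hb
  exact (continuousAt_fourthDeriv (z := z) (h.contDiffAt hx hy) hz hξ0 hξ0 ha0 hb0).add
    (continuousAt_thirdDeriv (z := z) (h.contDiffAt_three hx hy) hz hζ0 ha0 hb0)

/-- The second derivative in `t` of `c(γ 0, σ t) - c(γ 1, σ t)`, when `D_x c(γ 0, ·)` is affine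
along `σ` and `D_y c(·, σ t)` is affine along `γ`. -/
theorem neg_le_deriv_deriv (h : Admissible c X Y) {γ σ : ℝ → 𝔼 n} {t K : ℝ} {q w q' w' : 𝔼 n}
    (hK0 : 0 ≤ K) (hγX : ∀ s ∈ Icc (0 : ℝ) 1, γ s ∈ X) (hσY : σ t ∈ Y)
    (hγ : ∀ s ∈ Icc (0 : ℝ) 1, ContDiffAt ℝ 2 γ s) (hσ : ContDiffAt ℝ 2 σ t)
    (hq : ∀ s ∈ Icc (0 : ℝ) 1, ∀ᶠ r in 𝓝 s, gradY c (γ r) (σ t) = q + r • w)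
    (hq' : ∀ᶠ r in 𝓝 t, gradX c (γ 0) (σ r) = q' + r • w')
    (hK : ∀ s ∈ Icc (0 : ℝ) 1, crossForm c (γ s, σ t) (deriv γ s) (deriv (deriv γ) s)
      (deriv σ t) (deriv σ t) ≤ K) :
    -K ≤ deriv (deriv fun r => c (γ 0) (σ r) - c (γ 1) (σ r)) t := by
  set U := Function.uncurry c with hU
  set v := deriv σ t with hv
  set θ := deriv (deriv σ) t with hθ
  have i0 : (0 : ℝ) ∈ Icc (0 : ℝ) 1 := by simp
  have i1 : (1 : ℝ) ∈ Icc (0 : ℝ) 1 := by simp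
  have hA : ∀ s ∈ Icc (0 : ℝ) 1,
      ContDiffAt ℝ 2 (dirDeriv (0, v) (dirDeriv (0, v) U)) (γ s, σ t) := fun s hs =>
    h.contDiffAt_dirDeriv_dirDeriv_cost (hγX s hs) hσY _ _
  have hB : ∀ s ∈ Icc (0 : ℝ) 1, ContDiffAt ℝ 2 (dirDeriv (0, θ) U) (γ s, σ t) := fun s hs =>
    h.contDiffAt_dirDeriv_cost (hγX s hs) hσY _
  have hγp : ∀ s ∈ Icc (0 : ℝ) 1, ContDiffAt ℝ 2 (fun s => (γ s, σ t)) s := fun s hs =>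
    (hγ s hs).prodMk contDiffAt_const
  have hAγ : ∀ s ∈ Icc (0 : ℝ) 1,
      ContDiffAt ℝ 2 (fun s => dirDeriv (0, v) (dirDeriv (0, v) U) (γ s, σ t)) s := fun s hs =>
    ContDiffAt.comp (f := fun s => (γ s, σ t)) s (hA s hs) (hγp s hs)
  have hBγ : ∀ s ∈ Icc (0 : ℝ) 1,
      ContDiffAt ℝ 2 (fun s => dirDeriv (0, θ) U (γ s, σ t)) s := fun s hs =>
    ContDiffAt.comp (f := fun s => (γ s, σ t)) s (hB s hs) (hγp s hs)
  have hd2 : ∀ x ∈ X, ContDiffAt ℝ 2 (fun r => c x (σ r)) t ∧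
      deriv (deriv fun r => c x (σ r)) t =
      dirDeriv (0, v) (dirDeriv (0, v) U) (x, σ t) + dirDeriv (0, θ) U (x, σ t) := fun x hx =>
    ⟨ContDiffAt.comp (f := fun r => (x, σ r)) t (h.contDiffAt_two hx hσY)
      (contDiffAt_const.prodMk hσ),
      deriv_deriv_comp_right (g := U) (x := x) (h.contDiffAt_two hx hσY) hσ⟩
  -- The function of `s` is the second `t`-derivative of `c(x', σ t)` at the fixed point `x' = γ s`,
  -- so its values at `0` and `1` differ by the quantity to be bounded.
  have hmain := sub_le_of_deriv_deriv_le
    (f := fun s => dirDeriv (0, v) (dirDeriv (0, v) U) (γ s, σ t) + dirDeriv (0, θ) U (γ s, σ t))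
    hK0 (fun s hs => (hAγ s hs).add (hBγ s hs)) ?_ ?_
  · rw [deriv_deriv_sub (hd2 _ (hγX 0 i0)).1 (hd2 _ (hγX 1 i1)).1, (hd2 _ (hγX 0 i0)).2,
      (hd2 _ (hγX 1 i1)).2]
    linarith
  · have e1 := (hasDerivAt_comp_left ((hA 0 i0).differentiableAt (by norm_num))
      ((hγ 0 i0).differentiableAt (by norm_num))).add
      (hasDerivAt_comp_left ((hB 0 i0).differentiableAt (by norm_num))
      ((hγ 0 i0).differentiableAt (by norm_num)))
    refine e1.deriv.trans ?_
    -- After commuting derivatives, the slope at `s = 0` is the second derivative in `t` of the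
    -- component of `D_x c(γ 0, σ t)` along the fixed initial velocity of `γ`; it vanishes because
    -- `D_x c(γ 0, ·)` is affine along `σ`.
    rw [dirDeriv_comm₃ (h.contDiffAt_three (hγX 0 i0) hσY),
      dirDeriv_comm (h.contDiffAt_two (hγX 0 i0) hσY),
      ← deriv_deriv_comp_right (h.contDiffAt_dirDeriv_cost (hγX 0 i0) hσY _) hσ]
    exact h.affine_right (hγX 0 i0) hσY hσ hq' _
  · intro s hs
    rw [deriv_deriv_add (hAγ s hs) (hBγ s hs),
      (h.affine_left (hγX s hs) hσY (hγ s hs) (hq s hs) θ).1, add_zero,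
      deriv_deriv_comp_left (hA s hs) (hγ s hs), ← h.crossForm_eq (hγX s hs) hσY]
    exact hK s hs

/-- The height function along a `c`-segment satisfies `h'' ≥ -C |h'|`. -/
theorem exists_deriv_deriv_ge (h : Admissible c X Y)
    (hXc : ∀ y ∈ Y, Convex ℝ ((fun x => gradY c x y) '' X)) (hmtw : MTWZero c X Y)
    {xb x y₀ y₁ : 𝔼 n} (hxb : xb ∈ X) (hx : x ∈ X) (hne : x ≠ xb) (h₀ : y₀ ∈ Y) (h₁ : y₁ ∈ Y) :
    ∃ C : ℝ, ∀ t ∈ Icc (0 : ℝ) 1,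
      -(C * |deriv (fun r => c xb (cSeg c Y xb y₀ y₁ r) - c x (cSeg c Y xb y₀ y₁ r)) t|) ≤
        deriv (deriv fun r => c xb (cSeg c Y xb y₀ y₁ r) - c x (cSeg c Y xb y₀ y₁ r)) t := by
  set σ := cSeg c Y xb y₀ y₁ with hσdef
  have hσY : ∀ t ∈ Icc (0 : ℝ) 1, σ t ∈ Y := fun t ht => h.cSeg_mem hxb h₀ h₁ ht
  have hσ3 : ∀ t ∈ Icc (0 : ℝ) 1, ContDiffAt ℝ 3 σ t := fun t ht =>
    (h.contDiffAt_cSeg hxb h₀ h₁ ht).1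
  have hσ2 : ∀ t ∈ Icc (0 : ℝ) 1, ContDiffAt ℝ 2 σ t := fun t ht => (hσ3 t ht).of_le (by norm_num)
  obtain ⟨R, hR⟩ := h.exists_smooth_inverse_gradY
  set w : ℝ → 𝔼 n := fun t => gradY c x (σ t) - gradY c xb (σ t) with hw
  -- For fixed `t`, `F (·, t)` joins `xb` to `x` and `D_y c(·, σ t)` is affine along it; convexity
  -- of `D_y c(X, σ t)` keeps it in `X`.
  set q : ℝ × ℝ → 𝔼 n := fun z => gradY c xb (σ z.2) + z.1 • w z.2 with hq
  set F : ℝ × ℝ → 𝔼 n := fun z => R (q z, σ z.2) with hF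
  have hgσ : ∀ x ∈ X, ∀ t ∈ Icc (0 : ℝ) 1, ContDiffAt ℝ 3 (fun t => gradY c x (σ t)) t :=
    fun x hx t ht => ContDiffAt.comp (f := fun t => (x, σ t))
      (g := fun z : (𝔼 n) × (𝔼 n) => gradY c z.1 z.2) t (h.contDiffAt_gradY hx (hσY t ht))
      (contDiffAt_const.prodMk (hσ3 t ht))
  have hw3 : ∀ t ∈ Icc (0 : ℝ) 1, ContDiffAt ℝ 3 w t := fun t ht =>
    (hgσ x hx t ht).sub (hgσ xb hxb t ht)
  have hw0 : ∀ t ∈ Icc (0 : ℝ) 1, w t ≠ 0 := fun t ht h0 =>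
    hne (h.condC2 _ (hσY t ht) hx hxb (congrArg Neg.neg (sub_eq_zero.1 h0)))
  have hq3 : ∀ s, ∀ t ∈ Icc (0 : ℝ) 1, ContDiffAt ℝ 3 q (s, t) := fun s t ht =>
    (ContDiffAt.comp (f := Prod.snd) (s, t) (hgσ xb hxb t ht) contDiffAt_snd).add
      (contDiffAt_fst.smul (ContDiffAt.comp (f := Prod.snd) (s, t) (hw3 t ht) contDiffAt_snd))
  have hpt : ∀ s ∈ Icc (0 : ℝ) 1, ∀ t ∈ Icc (0 : ℝ) 1, ∃ x' ∈ X, gradY c x' (σ t) = q (s, t) := by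
    intro s hs t ht
    obtain ⟨x', hx', he⟩ := hXc _ (hσY t ht) (mem_image_of_mem _ hxb) (mem_image_of_mem _ hx)
      (sub_nonneg.2 hs.2) hs.1 (by ring)
    refine ⟨x', hx', he.trans ?_⟩
    simp only [hq, hw]
    module
  have hF3 : ∀ s ∈ Icc (0 : ℝ) 1, ∀ t ∈ Icc (0 : ℝ) 1, ContDiffAt ℝ 3 F (s, t) := by
    intro s hs t ht
    obtain ⟨x', hx', he⟩ := hpt s hs t ht
    have h2 := (hR x' hx' _ (hσY t ht)).2.1
    rw [he] at h2
    exact ContDiffAt.comp (f := fun z : ℝ × ℝ => (q z, σ z.2)) (s, t) h2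
      ((hq3 s t ht).prodMk (ContDiffAt.comp (f := Prod.snd) (s, t) (hσ3 t ht) contDiffAt_snd))
  have hFX : ∀ s ∈ Icc (0 : ℝ) 1, ∀ t ∈ Icc (0 : ℝ) 1, ∀ᶠ r in 𝓝 s,
      F (r, t) ∈ X ∧ gradY c (F (r, t)) (σ t) = gradY c xb (σ t) + r • w t := by
    intro s hs t ht
    obtain ⟨x', hx', he⟩ := hpt s hs t ht
    have h3 := (hR x' hx' _ (hσY t ht)).2.2
    rw [he] at h3
    have hc : ContinuousAt (fun r => (q (r, t), σ t)) s := by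
      simp only [hq]; fun_prop
    exact hc.eventually h3
  have hF0 : ∀ t ∈ Icc (0 : ℝ) 1, F (0, t) = xb := by
    intro t ht
    have : F (0, t) = R (gradY c xb (σ t), σ t) := by simp [hF, hq]
    rw [this, (hR xb hxb _ (hσY t ht)).1]
  have hF1 : ∀ t ∈ Icc (0 : ℝ) 1, F (1, t) = x := by
    intro t ht
    have : F (1, t) = R (gradY c x (σ t), σ t) := by simp [hF, hq, hw]
    rw [this, (hR x hx _ (hσY t ht)).1]
  set ξ : ℝ × ℝ → 𝔼 n := fun z => fderiv ℝ F z (1, 0) with hξ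
  set ζ : ℝ × ℝ → 𝔼 n := fun z => fderiv ℝ ξ z (1, 0) with hζ
  have hξ2 : ∀ s ∈ Icc (0 : ℝ) 1, ∀ t ∈ Icc (0 : ℝ) 1, ContDiffAt ℝ 2 ξ (s, t) := fun s hs t ht =>
    ((hF3 s hs t ht).fderiv_right (by norm_num)).clm_apply contDiffAt_const
  have hζ1 : ∀ s ∈ Icc (0 : ℝ) 1, ∀ t ∈ Icc (0 : ℝ) 1, ContDiffAt ℝ 1 ζ (s, t) := fun s hs t ht =>
    ((hξ2 s hs t ht).fderiv_right (by norm_num)).clm_apply contDiffAt_const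
  set v : ℝ → 𝔼 n := deriv σ with hv
  -- Normalised so that `w · e = 1`; thus `u = v - (w · v) e` is orthogonal to `w`. Here `w` does
  -- not vanish, by (C2) and `x ≠ xb`.
  set e : ℝ → 𝔼 n := fun t => (‖w t‖ ^ 2)⁻¹ • w t with he
  set l : ℝ → ℝ := fun t => inner ℝ (w t) (v t) with hl
  set u : ℝ → 𝔼 n := fun t => v t - l t • e t with hu
  have hvc : ∀ t ∈ Icc (0 : ℝ) 1, ContinuousAt v t := fun t ht =>
    (contDiffAt_deriv (k := 1) (by norm_num; exact hσ2 t ht)).continuousAt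
  have hwc : ∀ t ∈ Icc (0 : ℝ) 1, ContinuousAt w t := fun t ht => (hw3 t ht).continuousAt
  have hec : ∀ t ∈ Icc (0 : ℝ) 1, ContinuousAt e t := fun t ht =>
    (((hwc t ht).norm.pow 2).inv₀ (pow_ne_zero 2 (norm_ne_zero_iff.2 (hw0 t ht)))).smul (hwc t ht)
  have huc : ∀ t ∈ Icc (0 : ℝ) 1, ContinuousAt u t := fun t ht =>
    (hvc t ht).sub (ContinuousAt.smul (f := l) ((hwc t ht).inner (hvc t ht)) (hec t ht))
  have hFX' : ∀ s ∈ Icc (0 : ℝ) 1, ∀ t ∈ Icc (0 : ℝ) 1, F (s, t) ∈ X := fun s hs t ht =>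
    (hFX s hs t ht).self_of_nhds.1
  have hcont : ContinuousOn (fun z : ℝ × ℝ =>
      crossForm c (F z, σ z.2) (ξ z) (ζ z) (u z.2) (e z.2) +
        crossForm c (F z, σ z.2) (ξ z) (ζ z) (e z.2) (v z.2)) (Icc 0 1 ×ˢ Icc 0 1) := by
    rintro ⟨s, t⟩ ⟨hs, ht⟩
    have hsnd : ∀ {g : ℝ → 𝔼 n}, ContinuousAt g t →
        ContinuousAt (fun z : ℝ × ℝ => g z.2) (s, t) := fun hg =>
      ContinuousAt.comp (f := Prod.snd) hg continuousAt_snd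
    have hz : ContinuousAt (fun z : ℝ × ℝ => (F z, σ z.2)) (s, t) :=
      (hF3 s hs t ht).continuousAt.prodMk (hsnd (hσ3 t ht).continuousAt)
    refine ContinuousAt.continuousWithinAt (ContinuousAt.add ?_ ?_)
    · exact h.continuousAt_crossForm (hFX' s hs t ht) (hσY t ht) hz (hξ2 s hs t ht).continuousAt
        (hζ1 s hs t ht).continuousAt (hsnd (huc t ht)) (hsnd (hec t ht))
    · exact h.continuousAt_crossForm (hFX' s hs t ht) (hσY t ht) hz (hξ2 s hs t ht).continuousAt
        (hζ1 s hs t ht).continuousAt (hsnd (hec t ht)) (hsnd (hvc t ht))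
  -- Compactness of the square in `(s, t)` makes the constant independent of `t`.
  obtain ⟨C, hC⟩ := (isCompact_Icc.prod isCompact_Icc).exists_bound_of_continuousOn hcont
  refine ⟨C, fun t ht => ?_⟩
  have hC0 : 0 ≤ C := (norm_nonneg _).trans (hC (0, 0) (by simp))
  have hderiv : deriv (fun r => c xb (σ r) - c x (σ r)) t = -l t := by
    have hd : ∀ x ∈ X, HasDerivAt (fun r => c x (σ r)) (inner ℝ (gradY c x (σ t)) (v t)) t := by
      intro x hx
      rw [h.inner_gradY hx (hσY t ht)]
      exact hasDerivAt_comp_right (g := Function.uncurry c)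
        ((h.contDiffAt_two hx (hσY t ht)).differentiableAt (by norm_num))
        ((hσ2 t ht).differentiableAt (by norm_num))
    refine ((hd xb hxb).sub (hd x hx)).deriv.trans ?_
    simp only [hl, hw, inner_sub_left]
    ring
  have hγ := fun s hs => derivs_horizontal (hF3 s hs t ht)
  have hmain := h.neg_le_deriv_deriv (γ := fun s => F (s, t)) (σ := σ) (t := t) (K := C * |l t|)
    (by positivity) (fun s hs => hFX' s hs t ht) (hσY t ht)
    (fun s hs => (hγ s hs).1.of_le (by norm_num)) (hσ2 t ht)
    (fun s hs => (hFX s hs t ht).mono fun r hr => hr.2)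
    (q' := gradX c xb y₀) (w' := gradX c xb y₁ - gradX c xb y₀)
    (by
      simp only [hF0 t ht]
      exact (h.contDiffAt_cSeg hxb h₀ h₁ ht).2.mono fun r hr => hr.2) ?_
  · simp only [hF0 t ht, hF1 t ht] at hmain
    rwa [hderiv, abs_neg]
  · intro s hs
    rw [(hγ s hs).2.1, (hγ s hs).2.2]
    change crossForm c (F (s, t), σ t) (ξ (s, t)) (ζ (s, t)) (v t) (v t) ≤ C * |l t|
    have hwu : inner ℝ (w t) (u t) = 0 := by
      have hwn : ‖w t‖ ^ 2 ≠ 0 := pow_ne_zero 2 (norm_ne_zero_iff.2 (hw0 t ht))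
      simp only [hu, he, inner_sub_right, inner_smul_right, real_inner_self_eq_norm_sq]
      rw [inv_mul_cancel₀ hwn, mul_one, sub_self]
    have hm := h.mtw_dual hmtw (γ := fun s => F (s, t)) (s := s) (hFX' s hs t ht) (hσY t ht)
      ((hγ s hs).1.of_le (by norm_num)) ((hFX s hs t ht).mono fun r hr => hr.2) hwu
    rw [(hγ s hs).2.1, (hγ s hs).2.2, ← h.crossForm_eq (hFX' s hs t ht) (hσY t ht)] at hm
    change crossForm c (F (s, t), σ t) (ξ (s, t)) (ζ (s, t)) (u t) (u t) ≤ 0 at hm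
    have hvu : v t = u t + l t • e t := by simp only [hu]; abel
    have hCst := hC (s, t) ⟨hs, ht⟩
    rw [Real.norm_eq_abs] at hCst
    -- By bilinearity the form at `(v, v)` is its value at `(u, u)`, nonpositive by `mtw_dual`, plus
    -- a remainder with factor `l t = -h'(t)`.
    have hsplit : crossForm c (F (s, t), σ t) (ξ (s, t)) (ζ (s, t)) (v t) (v t) =
        crossForm c (F (s, t), σ t) (ξ (s, t)) (ζ (s, t)) (u t) (u t) +
        l t * (crossForm c (F (s, t), σ t) (ξ (s, t)) (ζ (s, t)) (u t) (e t) +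
          crossForm c (F (s, t), σ t) (ξ (s, t)) (ζ (s, t)) (e t) (v t)) := by
      conv_lhs => rw [show crossForm c (F (s, t), σ t) (ξ (s, t)) (ζ (s, t)) (v t) (v t) =
        crossForm c (F (s, t), σ t) (ξ (s, t)) (ζ (s, t)) (u t + l t • e t) (v t) by rw [← hvu]]
      rw [crossForm_add_smul_left]
      have : crossForm c (F (s, t), σ t) (ξ (s, t)) (ζ (s, t)) (u t) (v t) =
          crossForm c (F (s, t), σ t) (ξ (s, t)) (ζ (s, t)) (u t) (u t + l t • e t) := by
        rw [← hvu]
      rw [this, crossForm_add_smul_right]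
      ring
    rw [hsplit]
    have hb : l t * (crossForm c (F (s, t), σ t) (ξ (s, t)) (ζ (s, t)) (u t) (e t) +
          crossForm c (F (s, t), σ t) (ξ (s, t)) (ζ (s, t)) (e t) (v t)) ≤ C * |l t| := by
      refine (le_abs_self _).trans ?_
      rw [abs_mul, mul_comm]
      exact mul_le_mul_of_nonneg_right hCst (abs_nonneg _)
    linarith

theorem cSegInequality_of_mtwZero (h : Admissible c X Y)
    (hXc : ∀ y ∈ Y, Convex ℝ ((fun x => gradY c x y) '' X)) (hmtw : MTWZero c X Y) :
    CSegInequality c X Y := by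
  intro xb hxb y₀ h₀ y₁ h₁ _ x hx t ht
  -- The case `x = xb` is set apart because there `w` vanishes; the inequality is then trivial.
  rcases eq_or_ne x xb with rfl | hne
  · simp
  obtain ⟨C, hC⟩ := h.exists_deriv_deriv_ge hXc hmtw hxb hx hne h₀ h₁
  have hsm : ∀ z ∈ X, ∀ t ∈ Icc (0 : ℝ) 1,
      ContDiffAt ℝ 2 (fun r => c z (cSeg c Y xb y₀ y₁ r)) t := fun z hz t ht =>
    ContDiffAt.comp (f := fun r => (z, cSeg c Y xb y₀ y₁ r)) t
      (h.contDiffAt_two hz (h.cSeg_mem hxb h₀ h₁ ht))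
      (contDiffAt_const.prodMk ((h.contDiffAt_cSeg hxb h₀ h₁ ht).1.of_le (by norm_num)))
  have hmax := le_max_of_deriv_deriv_ge
    (fun t ht => (hsm xb hxb t ht).sub (hsm x hx t ht)) hC ht
  simp only [h.cSeg_zero hxb h₀, h.cSeg_one hxb h₁] at hmax
  rcases le_max_iff.1 hmax with h2 | h2
  · exact (min_le_left _ _).trans (by linarith)
  · exact (min_le_right _ _).trans (by linarith)

end Admissible

end OptimalTransport

theorem mainTheorem6 {n : ℕ}
    (c : EuclideanSpace ℝ (Fin n) → EuclideanSpace ℝ (Fin n) → ℝ)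
    (X Y : Set (EuclideanSpace ℝ (Fin n)))
    (hX : IsOpen X) (hY : IsOpen Y) (hYb : Bornology.IsBounded Y)
    (hC0 : OptimalTransport.CondC0 c X Y) (hC1 : OptimalTransport.CondC1 c X Y)
    (hC2 : OptimalTransport.CondC2 c X Y) (hC3 : OptimalTransport.CondC3 c X Y)
    -- the values of `c` on `X × ∂Y` are those of its continuous extension
    (hext : ContinuousOn (Function.uncurry c) (X ×ˢ closure Y))
    -- the target is `c`-convex
    (hYc : ∀ x ∈ X, Convex ℝ ((fun y => OptimalTransport.gradX c x y) '' Y)) :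
    -- conditions (i), (ii), (iii) are equivalent and imply (iv)
    List.TFAE [OptimalTransport.ConnectedSubdiffs c X Y, OptimalTransport.ConvexSubdiffs c X Y,
      OptimalTransport.CSegInequality c X Y] ∧
    (OptimalTransport.CSegInequality c X Y → OptimalTransport.MTWZero c X Y) ∧
    -- all four are equivalent when the source is `c`-convex too
    ((∀ y ∈ Y, Convex ℝ ((fun x => OptimalTransport.gradY c x y) '' X)) →
      List.TFAE [OptimalTransport.ConnectedSubdiffs c X Y, OptimalTransport.ConvexSubdiffs c X Y,
        OptimalTransport.CSegInequality c X Y, OptimalTransport.MTWZero c X Y]) ∧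
    -- non-density when one of them fails
    ((∃ L, ∀ y ∈ Y, LipschitzOnWith L (fun x => c x y) X) →
      (¬ OptimalTransport.ConnectedSubdiffs c X Y ∨ ¬ OptimalTransport.ConvexSubdiffs c X Y ∨
        ¬ OptimalTransport.CSegInequality c X Y ∨ ¬ OptimalTransport.MTWZero c X Y) →
      ¬ OptimalTransport.C1Dense c X Y) := by
  have h : OptimalTransport.Admissible c X Y := ⟨hX, hY, hYb, hC0, hC1, hC2, hC3, hext, hYc⟩
  have h123 := h.tfae_cSegInequality
  refine ⟨h123, h.mtwZero_of_cSegInequality, fun hXc => ?_, fun hlip hfail hd => ?_⟩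
  · tfae_have 1 ↔ 3 := h123.out 0 2
    tfae_have 2 ↔ 3 := h123.out 1 2
    tfae_have 3 → 4 := h.mtwZero_of_cSegInequality
    tfae_have 4 → 3 := h.cSegInequality_of_mtwZero hXc
    tfae_finish
  -- Density gives (iii), which implies the other three conditions without convexity of `D_y c(X,
  -- y)`, so whichever one fails is contradicted.
  · have h3 := h.cSegInequality_of_c1Dense hlip hd
    rcases hfail with hf | hf | hf | hf
    · exact hf (h.connectedSubdiffs_of_cSegInequality h3)
    · exact hf (h.convexSubdiffs_of_cSegInequality h3)
    · exact hf h3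
    · exact hf (h.mtwZero_of_cSegInequality h3)
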